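/- **Setting.** Let $T<\infty$, let $(\Omega,\mathscr F,\mathbb P)$ be a complete probability space carrying an $(m+n)$-dimensional standard Brownian motion $\overline W=(W,W^\perp)$ on $[0,T]$ ($W$ the first $m$ and $W^\perp$ the last $n$ components), and let $(\mathcal F_t)_{0\le t\le T}$ be the filtration generated by $\overline W$, augmented by the $\mathbb P$-null sets. Let $\lambda$ be a uniformly bounded $\mathbf R^m$-valued process, predictable with respect to $\mathcal F^W_t=\sigma(W_s,\,s\le t)$, let $S_0\in\mathbf R^m$, and $S_t=S_0+\int_0^t\lambda_s\,ds+W_t$. Let $\mathcal M$ be the set of probability measures $\mathbb Q$ equivalent to $\mathbb P$ under which $(S_t)_{t\in[0,T]}$ is a local martingale, and let $\mathbb Q^{min}$ be defined by $$\frac{d\mathbb Q^{min}}{d\mathbb P}=\exp\Big(-\int_0^T\lambda_s\cdot dW_s-\frac12\int_0^T|\lambda_s|^2ds\Big).$$ For $\mathbb Q\in\mathcal M$ write $D_t=D_t^{\mathbb Q,\mathbb Q^{min}}=\mathbb E_{\mathbb Q^{min}}\big[\tfrac{d\mathbb Q}{d\mathbb Q^{min}}\big|\mathcal F_t\big]$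 and $D_{t,T}=D_{t,T}^{\mathbb Q,\mathbb Q^{min}}=D_T/D_t$. Let $q>0$, $q\ne1$, and set $\ln_q x=\frac{x^{1-q}-1}{1-q}$ (for $x\ge0$ if $q<1$, for $x>0$ if $q>1$) and $\exp_q(x)=[1+(1-q)x]^{\frac1{1-q}}$ (for $x\ge-\frac1{1-q}$ if $q<1$, for $x<-\frac1{1-q}$ if $q>1$). Put $$H_q(\mathbb Q|\mathbb Q^{min})=\mathbb E_{\mathbb Q^{min}}\big[D_T^q\ln_qD_T\big]\in(-\infty,+\infty],\qquad H_{q,t}(\mathbb Q|\mathbb Q^{min})=\mathbb E_{\mathbb Q^{min}}\big[D_{t,T}^q\ln_qD_{t,T}\big|\mathcal F_t\big],$$ and $\mathcal M_f=\{\mathbb Q\in\mathcal M: H_q(\mathbb Q|\mathbb Q^{min})<+\infty\}$. For $\gamma>0$ let $\mathcal L_q^\gamma(\mathcal F_T,b)$ be the set of $\mathcal F_T$-measurable random variables $\xi$ such that a.s. $-\gamma\xi$ lies in the domain of $\exp_q$, $\exp_q(-\gamma\xi)\in L^1(\mathbb P)$, $\mathbb E_{\mathbb P}[\exp_q(-\gamma\xi)]$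 lies in the domain of $\ln_q$, and there are constants $m_1,m_2$ with $0<m_1\le\exp_q(-\gamma\xi)\le m_2$ a.s. For such $\xi$ and $t\in[0,T]$ define $$F_t(\xi,\gamma)=\operatorname*{ess\,inf}_{\mathbb Q\in\mathcal M_f}\Big(\mathbb E_{\mathbb Q^{min}}\big[(D_{t,T}^{\mathbb Q,\mathbb Q^{min}})^q\,\xi\,\big|\,\mathcal F_t\big]+\frac1\gamma H_{q,t}(\mathbb Q|\mathbb Q^{min})\Big).$$ Conditional expectations of random variables that need not be integrable are understood as the difference of the conditional expectations of the positive and the negative part, and essential infima are taken among extended-real-valued random variables. **Corollary.** Let $q>0$, $q\neq1$ and $\gamma>0$. For each $t\in[0,T]$ and each $\xi\in\mathcal L_q^\gamma(\mathcal F_T,b)$, $\mathbb P$-almost surely, $$\operatorname*{ess\,inf}_{\mathbb Q\in\mathcal M_f}\mathbb E_{\mathbb Q^{min}}\big[(D_{t,T}^{\mathbb Q,\mathbb Q^{min}})^q\,\xi\,\big|\,\mathcal F_t\big]\;\le\;F_t(\xi,\gamma)\;\le\;\mathbb E_{\mathbb Q^{min}}[\xi\,|\,\mathcal F_t].$$ 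-/

import Mathlib

open MeasureTheory ProbabilityTheory Filter Topology
open scoped NNReal ENNReal

noncomputable section

namespace TsallisPricing

/-! ### Essential infimum of an arbitrary family of extended-real random variables -/

section EssInf

variable {Ω ι : Type*} [MeasurableSpace Ω]

/-- `g` is the essential infimum under `P` of the family `f`: it is measurable, it is an
a.s. lower bound of every member, and it a.s. dominates every measurable a.s. lower bound. -/
structure IsEssInf (P : Measure Ω) (f : ι → Ω → EReal) (g : Ω → EReal) : Prop where
  measurable : Measurable g
  le : ∀ i, ∀ᵐ ω ∂P, g ω ≤ f i ω
  greatest : ∀ h : Ω → EReal, Measurable h → (∀ i, ∀ᵐ ω ∂P, h ω ≤ f i ω) → ∀ᵐ ω ∂P, h ω ≤ g ω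

/-- A strictly increasing measurable map from the extended reals into `[0, 1]`. -/
def squash (x : EReal) : ℝ≥0∞ := ENNReal.orderIsoIicOneBirational (EReal.exp x)

lemma squash_strictMono : StrictMono squash := fun _ _ h =>
  ENNReal.orderIsoIicOneBirational.strictMono (EReal.exp_strictMono h)

lemma squash_le_one (x : EReal) : squash x ≤ 1 :=
  (ENNReal.orderIsoIicOneBirational (EReal.exp x)).2

theorem exists_isEssInf (P : Measure Ω) [IsFiniteMeasure P] (f : ι → Ω → EReal) :
    ∃ g, IsEssInf P f g := by
  classical
  have hmeas : Measurable squash := squash_strictMono.monotone.measurable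
  let L : Set (Ω → EReal) := {h | Measurable h ∧ ∀ i, ∀ᵐ ω ∂P, h ω ≤ f i ω}
  let V : Set ℝ≥0∞ := (fun h : Ω → EReal => ∫⁻ ω, squash (h ω) ∂P) '' L
  have hVne : V.Nonempty :=
    ⟨_, ⟨fun _ => ⊥, ⟨measurable_const, fun i => by simp⟩, rfl⟩⟩
  obtain ⟨v, -, hv, hvV⟩ := exists_seq_tendsto_sSup hVne (OrderTop.bddAbove V)
  choose h hL hval using hvV
  refine ⟨fun ω => ⨆ k, h k ω, ?_⟩
  have hgm : Measurable (fun ω => ⨆ k, h k ω) := Measurable.iSup fun k => (hL k).1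
  have hgle : ∀ i, ∀ᵐ ω ∂P, (⨆ k, h k ω) ≤ f i ω := fun i => by
    filter_upwards [ae_all_iff.2 fun k => (hL k).2 i] with ω hω
    exact iSup_le hω
  refine ⟨hgm, hgle, fun u hu hule => ?_⟩
  have hsup : sSup V ≤ ∫⁻ ω, squash (⨆ k, h k ω) ∂P := by
    refine le_of_tendsto' hv fun k => ?_
    rw [← hval k]
    exact lintegral_mono fun ω => squash_strictMono.monotone (le_iSup (fun k => h k ω) k)
  have hmax : (∫⁻ ω, squash (max (u ω) (⨆ k, h k ω)) ∂P) ≤ sSup V := by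
    refine le_sSup ⟨fun ω => max (u ω) (⨆ k, h k ω), ⟨hu.max hgm, fun i => ?_⟩, rfl⟩
    filter_upwards [hule i, hgle i] with ω h1 h2 using max_le h1 h2
  have hfin : (∫⁻ ω, squash (⨆ k, h k ω) ∂P) ≠ ∞ := by
    refine ne_top_of_le_ne_top (measure_ne_top P Set.univ) ?_
    calc (∫⁻ ω, squash (⨆ k, h k ω) ∂P) ≤ ∫⁻ _, 1 ∂P := lintegral_mono fun ω => squash_le_one _
      _ = P Set.univ := by simp
  have hae := ae_eq_of_ae_le_of_lintegral_le (μ := P)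
    (f := fun ω => squash (⨆ k, h k ω)) (g := fun ω => squash (max (u ω) (⨆ k, h k ω)))
    (ae_of_all _ fun ω => squash_strictMono.monotone (le_max_right _ _)) hfin
    (hmeas.comp (hu.max hgm)).aemeasurable (hmax.trans hsup)
  filter_upwards [hae] with ω hω
  have := squash_strictMono.injective hω
  rw [this]
  exact le_max_left _ _

/-- The essential infimum (unique up to a.s. equality) of a family of random variables. -/
def essInfFamily (P : Measure Ω) [IsFiniteMeasure P] (f : ι → Ω → EReal) : Ω → EReal :=
  Classical.choose (exists_isEssInf P f)

theorem isEssInf_essInfFamily (P : Measure Ω) [IsFiniteMeasure P] (f : ι → Ω → EReal) :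
    IsEssInf P f (essInfFamily P f) :=
  Classical.choose_spec (exists_isEssInf P f)

end EssInf

/-! ### The deformed logarithm and exponential, conditional expectations -/

/-- `q`-logarithm. -/
def lnq (q x : ℝ) : ℝ := (x ^ (1 - q) - 1) / (1 - q)

/-- `q`-exponential. -/
def expq (q x : ℝ) : ℝ := (1 + (1 - q) * x) ^ (1 / (1 - q))

/-- Domain of `lnq q`: `[0, ∞)` for `q < 1` and `(0, ∞)` for `q > 1`. -/
def domLnq (q : ℝ) : Set ℝ := {x | (q < 1 ∧ 0 ≤ x) ∨ (1 < q ∧ 0 < x)}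

/-- Domain of `expq q`: `x ≥ -1/(1-q)` for `q < 1` and `x < -1/(1-q)` for `q > 1`. -/
def domExpq (q : ℝ) : Set ℝ :=
  {x | (q < 1 ∧ -(1 / (1 - q)) ≤ x) ∨ (1 < q ∧ x < -(1 / (1 - q)))}

/-- Conditional expectation `E[f⁺ | 𝓖] - E[f⁻ | 𝓖]` of a real random variable which need not be
integrable, through conditional expectations of nonnegative random variables. -/
def genCondExp {Ω : Type*} {mΩ : MeasurableSpace Ω} (Q : Measure Ω) (𝓖 : MeasurableSpace Ω)
    (f : Ω → ℝ) (ω : Ω) : EReal :=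
  (condLExp 𝓖 Q (fun ω' => ENNReal.ofReal (f ω')) ω : EReal) -
    (condLExp 𝓖 Q (fun ω' => ENNReal.ofReal (-f ω')) ω : EReal)

/-! ### Brownian motion, filtrations, local martingales, Itô integrals on `[0, T]`

Stochastic processes are indexed by `ℝ≥0`, but only their values at times `≤ T` are ever used. -/

section StochProc

variable {Ω : Type*} {mΩ : MeasurableSpace Ω}

/-- Standard Brownian motion on `[0, T]` with values in `ℝ^d`. -/
structure IsBrownianMotionOn {d : ℕ} (P : Measure Ω) (T : ℝ≥0)
    (B : ℝ≥0 → Ω → EuclideanSpace ℝ (Fin d)) : Prop where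
  measurable : ∀ t ≤ T, Measurable (B t)
  start : ∀ᵐ ω ∂P, B 0 ω = 0
  law_increment : ∀ s t, s ≤ t → t ≤ T →
    HasLaw (fun ω (i : Fin d) => B t ω i - B s ω i)
      (Measure.pi fun _ : Fin d => gaussianReal 0 (t - s)) P
  indep_increment : ∀ s t, s ≤ t → t ≤ T →
    Indep (⨆ u, ⨆ _ : u ≤ s, MeasurableSpace.comap (B u) inferInstance)
      (MeasurableSpace.comap (fun ω => B t ω - B s ω) inferInstance) P
  continuous : ∀ᵐ ω ∂P, ContinuousOn (fun t => B t ω) (Set.Iic T)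

/-- The raw filtration `σ(X_s, s ≤ t)`, `t ∈ [0, T]` (constant after time `T`). -/
def rawFiltration {d : ℕ} (T : ℝ≥0) (X : ℝ≥0 → Ω → EuclideanSpace ℝ (Fin d))
    (hX : ∀ t ≤ T, Measurable (X t)) : Filtration ℝ≥0 mΩ where
  seq t := ⨆ s, ⨆ _ : s ≤ min t T, MeasurableSpace.comap (X s) inferInstance
  mono' _ _ hst := iSup₂_le fun u hu =>
    le_iSup₂_of_le u (hu.trans (min_le_min_right T hst)) le_rfl
  le' _ := iSup₂_le fun u hu => (hX u (hu.trans (min_le_right _ _))).comap_le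

/-- The augmentation of a filtration by the null sets of a complete measure. -/
def augmentation (P : Measure Ω) [P.IsComplete] (𝓕 : Filtration ℝ≥0 mΩ) : Filtration ℝ≥0 mΩ where
  seq t := 𝓕 t ⊔ MeasurableSpace.generateFrom {A | P A = 0}
  mono' _ _ hst := sup_le_sup_right (𝓕.mono hst) _
  le' t := sup_le (𝓕.le t)
    (MeasurableSpace.generateFrom_le fun _ hA => measurableSet_of_null hA)

/-- `(X_t)_{t ∈ [0, T]}` is a local martingale under `Q`. -/
def IsLocalMartingaleOn {d : ℕ} (Q : Measure Ω) (𝓕 : Filtration ℝ≥0 mΩ) (T : ℝ≥0)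
    (X : ℝ≥0 → Ω → EuclideanSpace ℝ (Fin d)) : Prop :=
  Locally (fun Y => Martingale Y 𝓕 Q) 𝓕 (fun t => X (min t T)) Q

/-- Simple predictable integrands `∑_{j < N} ξ_j 1_{(t_j, t_{j+1}]}` with bounded
`𝓕_{t_j}`-measurable `ξ_j`. -/
structure SimpleIntegrand (𝓕 : Filtration ℝ≥0 mΩ) (d : ℕ) where
  N : ℕ
  time : ℕ → ℝ≥0
  mono : Monotone time
  val : ℕ → Ω → EuclideanSpace ℝ (Fin d)
  meas : ∀ j, StronglyMeasurable[𝓕 (time j)] (val j)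
  bdd : ∃ C : ℝ, ∀ j ω, ‖val j ω‖ ≤ C

/-- The process defined by a simple integrand. -/
def SimpleIntegrand.toFun {𝓕 : Filtration ℝ≥0 mΩ} {d : ℕ} (φ : SimpleIntegrand 𝓕 d)
    (s : ℝ≥0) (ω : Ω) : EuclideanSpace ℝ (Fin d) :=
  ∑ j ∈ Finset.range φ.N,
    (Set.Ioc (φ.time j) (φ.time (j + 1))).indicator (fun _ => φ.val j ω) s

/-- The elementary integral `∫_0^T φ · dW` of a simple integrand. -/
def SimpleIntegrand.integral {𝓕 : Filtration ℝ≥0 mΩ} {d : ℕ} (φ : SimpleIntegrand 𝓕 d)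
    (T : ℝ≥0) (W : ℝ≥0 → Ω → EuclideanSpace ℝ (Fin d)) (ω : Ω) : ℝ :=
  ∑ j ∈ Finset.range φ.N,
    inner ℝ (φ.val j ω) (W (min (φ.time (j + 1)) T) ω - W (min (φ.time j) T) ω)

/-- `I` is the Itô integral `∫_0^T H · dW` of a square-integrable integrand: the `L²(P)`-limit of
elementary integrals of simple integrands converging to `H` in `L²(P ⊗ dt)`. -/
def IsItoIntegral {d : ℕ} (P : Measure Ω) (𝓕 : Filtration ℝ≥0 mΩ) (T : ℝ≥0)
    (W H : ℝ≥0 → Ω → EuclideanSpace ℝ (Fin d)) (I : Ω → ℝ) : Prop :=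
  MemLp I 2 P ∧ ∃ φ : ℕ → SimpleIntegrand 𝓕 d,
    Tendsto (fun k => ∫⁻ ω, (∫⁻ s in Set.Ioc (0 : ℝ) T,
      ‖(φ k).toFun s.toNNReal ω - H s.toNNReal ω‖ₑ ^ 2) ∂P) atTop (𝓝 0) ∧
    Tendsto (fun k => ∫⁻ ω, ‖(φ k).integral T W ω - I ω‖ₑ ^ 2 ∂P) atTop (𝓝 0)

open Classical in
/-- The Itô integral `∫_0^T H · dW` (unique up to a.s. equality). -/
def itoIntegral {d : ℕ} (P : Measure Ω) (𝓕 : Filtration ℝ≥0 mΩ) (T : ℝ≥0)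
    (W H : ℝ≥0 → Ω → EuclideanSpace ℝ (Fin d)) : Ω → ℝ :=
  if h : ∃ I, IsItoIntegral P 𝓕 T W H I then Classical.choose h else 0

/-- The first `m` components of an `(m+n)`-dimensional process. -/
def firstComponents {m n : ℕ} (B : ℝ≥0 → Ω → EuclideanSpace ℝ (Fin (m + n))) (t : ℝ≥0) (ω : Ω) :
    EuclideanSpace ℝ (Fin m) :=
  WithLp.toLp 2 fun i => B t ω (Fin.castAdd n i)

lemma measurable_firstComponents {m n : ℕ} {B : ℝ≥0 → Ω → EuclideanSpace ℝ (Fin (m + n))}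
    {t : ℝ≥0} (h : Measurable (B t)) : Measurable (firstComponents B t) := by
  unfold firstComponents
  fun_prop

end StochProc

/-! ### The market -/

/-- The market model: a complete probability space carrying an `(m+n)`-dimensional Brownian
motion `B = (W, W^⊥)` on `[0, T]`, a bounded drift `lam`, predictable for the filtration
generated by `W`, and initial prices `S0`. -/
structure BrownianMarket (Ω : Type*) [MeasurableSpace Ω] (m n : ℕ) where
  P : Measure Ω
  isProbabilityMeasure : IsProbabilityMeasure P
  isComplete : P.IsComplete
  T : ℝ≥0
  B : ℝ≥0 → Ω → EuclideanSpace ℝ (Fin (m + n))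
  isBrownianMotion : IsBrownianMotionOn P T B
  lam : ℝ≥0 → Ω → EuclideanSpace ℝ (Fin m)
  lam_predictable : IsStronglyPredictable (rawFiltration T (firstComponents B)
    fun t ht => measurable_firstComponents (isBrownianMotion.measurable t ht)) lam
  lam_bounded : ∃ C : ℝ, ∀ t ≤ T, ∀ ω, ‖lam t ω‖ ≤ C
  S0 : EuclideanSpace ℝ (Fin m)

namespace BrownianMarket

attribute [instance] BrownianMarket.isProbabilityMeasure BrownianMarket.isComplete

variable {Ω : Type*} [mΩ : MeasurableSpace Ω] {m n : ℕ} (M : BrownianMarket Ω m n)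

/-- The Brownian motion `W` driving the traded assets. -/
def W : ℝ≥0 → Ω → EuclideanSpace ℝ (Fin m) := firstComponents M.B

/-- The augmented filtration generated by the whole Brownian motion `(W, W^⊥)`. -/
def 𝓕 : Filtration ℝ≥0 mΩ :=
  augmentation M.P (rawFiltration M.T M.B M.isBrownianMotion.measurable)

/-- Asset prices `S_t = S_0 + ∫_0^t λ_s ds + W_t`. -/
def S (t : ℝ≥0) (ω : Ω) : EuclideanSpace ℝ (Fin m) :=
  M.S0 + (∫ s in (0 : ℝ)..t, M.lam s.toNNReal ω) + M.W t ω

/-- Minimal martingale measure: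
`dQ^min/dP = exp(-∫_0^T λ_s · dW_s - (1/2) ∫_0^T |λ_s|² ds)`. -/
def Qmin : Measure Ω :=
  M.P.withDensity fun ω => ENNReal.ofReal (Real.exp
    (-itoIntegral M.P M.𝓕 M.T M.W M.lam ω
      - 1 / 2 * ∫ s in (0 : ℝ)..M.T, ‖M.lam s.toNNReal ω‖ ^ 2))

/-- The equivalent local martingale measures. -/
def martingaleMeasures : Set (Measure Ω) :=
  {Q | IsProbabilityMeasure Q ∧ Q ≪ M.P ∧ M.P ≪ Q ∧ IsLocalMartingaleOn Q M.𝓕 M.T M.S}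

/-- Density process `D_t^{Q,R} = E_R[dQ/dR | 𝓕_t]`. -/
def density (Q R : Measure Ω) (t : ℝ≥0) : Ω → ℝ :=
  R[fun ω => (Q.rnDeriv R ω).toReal | M.𝓕 t]

/-- `D_{s,t}^{Q,R} = D_t^{Q,R} / D_s^{Q,R}`. -/
def densityRatio (Q R : Measure Ω) (s t : ℝ≥0) (ω : Ω) : ℝ :=
  M.density Q R t ω / M.density Q R s ω

open Classical in
/-- Tsallis relative entropy on `𝓕_T`. The integrand is bounded below, so when it fails to be
integrable its integral is `+∞`. -/
def entropy (q : ℝ) (Q R : Measure Ω) : EReal :=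
  if Q ≪ R ∧ Integrable (fun ω => M.density Q R M.T ω ^ q * lnq q (M.density Q R M.T ω)) R then
    ((MeasureTheory.integral R fun ω =>
      M.density Q R M.T ω ^ q * lnq q (M.density Q R M.T ω) : ℝ) : EReal)
  else ⊤

/-- Conditional Tsallis relative entropy
`H_{q,t}(Q|R) = E_R[(D_{t,T})^q ln_q D_{t,T} | 𝓕_t]`. -/
def condEntropy (q : ℝ) (t : ℝ≥0) (Q R : Measure Ω) : Ω → EReal :=
  genCondExp R (M.𝓕 t) fun ω =>
    M.densityRatio Q R t M.T ω ^ q * lnq q (M.densityRatio Q R t M.T ω)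

/-- `𝓜_f`: equivalent local martingale measures with finite entropy relative to `Q^min`. -/
def finiteEntropyMeasures (q : ℝ) : Set (Measure Ω) :=
  {Q | Q ∈ M.martingaleMeasures ∧ M.entropy q Q M.Qmin < ⊤}

/-- The distorted expectation `E_{Q^min}[(D_{t,T}^{Q,Q^min})^q ξ | 𝓕_t]`. -/
def distortedExp (q : ℝ) (t : ℝ≥0) (ξ : Ω → ℝ) (Q : Measure Ω) : Ω → EReal :=
  genCondExp M.Qmin (M.𝓕 t) fun ω => M.densityRatio Q M.Qmin t M.T ω ^ q * ξ ω

/-- The pricing principle `F_t(ξ, γ)`. -/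
def price (q γ : ℝ) (t : ℝ≥0) (ξ : Ω → ℝ) : Ω → EReal :=
  essInfFamily M.P fun (Q : M.finiteEntropyMeasures q) ω =>
    M.distortedExp q t ξ Q ω + ((1 / γ : ℝ) : EReal) * M.condEntropy q t Q M.Qmin ω

/-- The essential infimum over `𝓜_f` of the distorted expectations, without penalty. -/
def worstDistortedExp (q : ℝ) (t : ℝ≥0) (ξ : Ω → ℝ) : Ω → EReal :=
  essInfFamily M.P fun (Q : M.finiteEntropyMeasures q) ω => M.distortedExp q t ξ Q ω

/-- The class of `q`-exponentially integrable claims. -/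
def claims (q γ : ℝ) : Set (Ω → ℝ) :=
  {ξ | Measurable[M.𝓕 M.T] ξ ∧ (∀ᵐ ω ∂M.P, -γ * ξ ω ∈ domExpq q) ∧
    Integrable (fun ω => expq q (-γ * ξ ω)) M.P ∧
    (∫ ω, expq q (-γ * ξ ω) ∂M.P) ∈ domLnq q}

/-- The class of `q`-exponentially bounded claims. -/
def boundedClaims (q γ : ℝ) : Set (Ω → ℝ) :=
  {ξ | ξ ∈ M.claims q γ ∧ ∃ m₁ m₂ : ℝ, 0 < m₁ ∧
    ∀ᵐ ω ∂M.P, m₁ ≤ expq q (-γ * ξ ω) ∧ expq q (-γ * ξ ω) ≤ m₂}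

end BrownianMarket

end TsallisPricing

end

/-! Two facts about the minimal martingale measure and the entropy penalty give the two
inequalities. For the lower bound, the penalty is nonnegative. Pointwise `x ^ q * lnq q x ≥ x - 1`,
by Bernoulli's inequality (`sub_one_le_rpow_mul_lnq`), and `D_{t,T}` has conditional mean one, so
`H_{q,t}(Q | Q^min) ≥ 0` for every `Q` (`condEntropy_nonneg`). Each penalised term therefore
dominates the unpenalised one, and so does the essential infimum. For the upper bound, `Q^min` is
used as a competitor: its density process relative to itself is one, so its penalty vanishes and its
distorted expectation is `E[ξ | 𝓕_t]`.

This requires `Q^min` to belong to `𝓜_f`. Its entropy is zero; the real work is to show that it is a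
probability measure under which `S` is a martingale (`martingale_S_Qmin`). Since the Itô integral is
defined only as a mean-square limit, this case of Girsanov's theorem is proved from Gaussian
increments upwards. Independence of increments yields the Itô isometry for elementary integrands.
Dyadic averages approximate a bounded predictable process, and the isometry passes the approximation
to the integrals. For simple integrands the stochastic exponential has mean one by induction over
the steps; boundedness in `L²` carries this to the limit (`lintegral_stochasticExponential`).

Applying that theorem to the drift minus `θ` on `(s, t] × A`, with `A ∈ 𝓕_s`, and completing the
square identifies the moment generating function of `⟨θ, S_t - S_s⟩` under `Q^min` restricted to
`A`. It is that of a centred Gaussian times `Q^min(A)`. Its derivative at zero vanishes, which is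
the martingale property. -/

noncomputable section

namespace TsallisPricing

/-! ### Centred isotropic Gaussian vectors -/

/-- The centred Gaussian law on `ℝ^m` with covariance matrix `v • 1`. -/
def isotropicGaussian (m : ℕ) (v : ℝ≥0) : Measure (EuclideanSpace ℝ (Fin m)) :=
  (Measure.pi fun _ : Fin m => gaussianReal 0 v).map (WithLp.toLp 2)

instance (m : ℕ) (v : ℝ≥0) : IsProbabilityMeasure (isotropicGaussian m v) :=
  Measure.isProbabilityMeasure_map (by fun_prop)

lemma charFun_isotropicGaussian (m : ℕ) (v : ℝ≥0) (x : EuclideanSpace ℝ (Fin m)) :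
    charFun (isotropicGaussian m v) x = Complex.exp (-(v * ‖x‖ ^ 2 / 2 : ℝ)) := by
  rw [isotropicGaussian]
  simp_rw [charFun_pi, charFun_gaussianReal, ← Complex.exp_sum, EuclideanSpace.real_norm_sq_eq]
  congr 1
  push_cast
  simp [Finset.mul_sum, Finset.sum_div]

/-- The characteristic function of `⟨x, ·⟩` at `s` is that of the vector at `s • x`. This reduces
the moment computations below to the one-dimensional Gaussian. -/
lemma map_inner_isotropicGaussian {m : ℕ} (v : ℝ≥0) (x : EuclideanSpace ℝ (Fin m)) :
    (isotropicGaussian m v).map (fun w => inner ℝ x w) = gaussianReal 0 (v * ‖x‖₊ ^ 2) := by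
  have hm : Measurable fun w : EuclideanSpace ℝ (Fin m) => (inner ℝ x w : ℝ) := by fun_prop
  have := Measure.isProbabilityMeasure_map (μ := isotropicGaussian m v) hm.aemeasurable
  refine Measure.ext_of_charFun ?_
  ext s
  have h1 : charFun ((isotropicGaussian m v).map fun w => (inner ℝ x w : ℝ)) s
      = charFun (isotropicGaussian m v) (s • x) := by
    rw [charFun_apply, charFun_apply, integral_map hm.aemeasurable (by fun_prop)]
    simp [real_inner_smul_right, real_inner_comm, mul_comm]
  rw [h1, charFun_isotropicGaussian, charFun_gaussianReal, norm_smul]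
  congr 1
  push_cast
  rw [mul_pow, Real.norm_eq_abs, ← Complex.ofReal_pow |s|, sq_abs]
  push_cast
  ring

lemma lintegral_exp_inner_isotropicGaussian {m : ℕ} (v : ℝ≥0) (x : EuclideanSpace ℝ (Fin m)) :
    ∫⁻ w, ENNReal.ofReal (Real.exp (inner ℝ x w - v * ‖x‖ ^ 2 / 2)) ∂(isotropicGaussian m v)
      = 1 := by
  have hm : Measurable fun w : EuclideanSpace ℝ (Fin m) => (inner ℝ x w : ℝ) := by fun_prop
  have h1 := lintegral_map (μ := isotropicGaussian m v)
    (f := fun r : ℝ => ENNReal.ofReal (Real.exp (r - v * ‖x‖ ^ 2 / 2))) (by fun_prop) hm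
  rw [← h1, map_inner_isotropicGaussian]
  have h2 : ∀ r : ℝ, ENNReal.ofReal (Real.exp (r - v * ‖x‖ ^ 2 / 2))
      = ENNReal.ofReal (Real.exp (1 * r)) * ENNReal.ofReal (Real.exp (-(v * ‖x‖ ^ 2 / 2))) := by
    intro r
    rw [← ENNReal.ofReal_mul (Real.exp_nonneg _), ← Real.exp_add, one_mul, sub_eq_add_neg]
  simp_rw [h2]
  rw [lintegral_mul_const _ (by fun_prop), ← ofReal_integral_eq_lintegral_ofReal
    (integrable_exp_mul_gaussianReal 1) (ae_of_all _ fun _ => Real.exp_nonneg _)]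
  have h3 := congr_fun (mgf_id_gaussianReal (μ := 0) (v := v * ‖x‖₊ ^ 2)) 1
  simp only [mgf, id] at h3
  rw [h3, ← ENNReal.ofReal_mul (Real.exp_nonneg _), ← Real.exp_add]
  simp

lemma lintegral_sq_inner_isotropicGaussian {m : ℕ} (v : ℝ≥0) (x : EuclideanSpace ℝ (Fin m)) :
    ∫⁻ w, ENNReal.ofReal ((inner ℝ x w) ^ 2) ∂(isotropicGaussian m v)
      = ENNReal.ofReal (v * ‖x‖ ^ 2) := by
  have hm : Measurable fun w : EuclideanSpace ℝ (Fin m) => (inner ℝ x w : ℝ) := by fun_prop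
  have h1 := lintegral_map (μ := isotropicGaussian m v)
    (f := fun r : ℝ => ENNReal.ofReal (r ^ 2)) (by fun_prop) hm
  rw [← h1, map_inner_isotropicGaussian]
  have h2 : MemLp (fun r : ℝ => r) 2 (gaussianReal 0 (v * ‖x‖₊ ^ 2)) := memLp_id_gaussianReal 2
  rw [← ofReal_integral_eq_lintegral_ofReal h2.integrable_sq (ae_of_all _ fun _ => sq_nonneg _)]
  have h3 := variance_of_integral_eq_zero (μ := gaussianReal 0 (v * ‖x‖₊ ^ 2)) (X := id)
    aemeasurable_id (by simp)
  rw [variance_id_gaussianReal] at h3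
  simp only [id] at h3 ⊢
  rw [← h3]
  simp

lemma integral_inner_isotropicGaussian {m : ℕ} (v : ℝ≥0) (x : EuclideanSpace ℝ (Fin m)) :
    ∫ w, inner ℝ x w ∂(isotropicGaussian m v) = 0 := by
  have hm : Measurable fun w : EuclideanSpace ℝ (Fin m) => (inner ℝ x w : ℝ) := by fun_prop
  have h1 := integral_map (μ := isotropicGaussian m v) hm.aemeasurable
    (f := fun r : ℝ => r) (by fun_prop)
  rw [← h1, map_inner_isotropicGaussian]
  simp

/-! ### Brownian motion relative to a filtration -/

variable {Ω : Type*} {mΩ : MeasurableSpace Ω} {m : ℕ}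

/-- `X` is a Brownian motion relative to `𝓕`, stopped at time `T`. -/
structure IsStoppedBrownian (P : Measure Ω) (𝓕 : Filtration ℝ≥0 mΩ) (T : ℝ≥0)
    (X : ℝ≥0 → Ω → EuclideanSpace ℝ (Fin m)) : Prop where
  adapted : ∀ t, Measurable[𝓕 t] (X t)
  law : ∀ s t, s ≤ t →
    P.map (fun ω => X t ω - X s ω) = isotropicGaussian m (min t T - min s T)
  indep : ∀ s t, s ≤ t →
    Indep (𝓕 s) (MeasurableSpace.comap (fun ω => X t ω - X s ω) inferInstance) P

namespace IsStoppedBrownian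

variable {P : Measure Ω} {𝓕 : Filtration ℝ≥0 mΩ} {T : ℝ≥0}
  {X : ℝ≥0 → Ω → EuclideanSpace ℝ (Fin m)}

lemma measurable (hX : IsStoppedBrownian P 𝓕 T X) (t : ℝ≥0) : Measurable (X t) :=
  (hX.adapted t).mono (𝓕.le t) le_rfl

variable {ξ η : Ω → EuclideanSpace ℝ (Fin m)}

lemma measurable_inner_increment (hX : IsStoppedBrownian P 𝓕 T X) {a s t : ℝ≥0} (ha : a ≤ t)
    (hs : s ≤ t) (hξ : Measurable[𝓕 a] ξ) :
    Measurable[𝓕 t] (fun ω => (inner ℝ (ξ ω) (X t ω - X s ω) : ℝ)) := by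
  have h1 := hX.adapted t
  have h2 := (hX.adapted s).mono (𝓕.mono hs) le_rfl
  have h3 := hξ.mono (𝓕.mono ha) le_rfl
  exact Measurable.inner h3 (h1.sub h2)

variable [IsProbabilityMeasure P]

/-- Independence of the past in product form: anything known at time `s` can be frozen while the
increment is integrated out. All one-step identities below come from this. -/
lemma map_prodMk (hX : IsStoppedBrownian P 𝓕 T X) {s t : ℝ≥0} (hst : s ≤ t) {α : Type*}
    [MeasurableSpace α] {Y : Ω → α} (hY : Measurable[𝓕 s] Y) :
    P.map (fun ω => (Y ω, X t ω - X s ω))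
      = (P.map Y).prod (isotropicGaussian m (min t T - min s T)) := by
  have h : IndepFun Y (fun ω => X t ω - X s ω) P :=
    (IndepFun_iff_Indep _ _ _).2 (indep_of_indep_of_le_left (hX.indep s t hst) hY.comap_le)
  rw [← hX.law s t hst]
  exact (indepFun_iff_map_prod_eq_prod_map_map (hY.mono (𝓕.le s) le_rfl).aemeasurable
    ((hX.measurable t).sub (hX.measurable s)).aemeasurable).1 h

lemma lintegral_comp_increment (hX : IsStoppedBrownian P 𝓕 T X) {s t : ℝ≥0} (hst : s ≤ t)
    {α : Type*} [MeasurableSpace α] {Y : Ω → α} (hY : Measurable[𝓕 s] Y)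
    {g : α → EuclideanSpace ℝ (Fin m) → ℝ≥0∞} (hg : Measurable (Function.uncurry g)) :
    ∫⁻ ω, g (Y ω) (X t ω - X s ω) ∂P
      = ∫⁻ ω, ∫⁻ w, g (Y ω) w ∂(isotropicGaussian m (min t T - min s T)) ∂P := by
  have hY' : Measurable Y := hY.mono (𝓕.le s) le_rfl
  have h1 := lintegral_map (μ := P) hg
    (hY'.prodMk ((hX.measurable t).sub (hX.measurable s)))
  have h2 := lintegral_map (μ := P) (hg.lintegral_prod_right'
    (ν := isotropicGaussian m (min t T - min s T))) hY'
  have h3 := hX.map_prodMk hst hY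
  change ∫⁻ a, _ ∂(P.map fun ω => (Y ω, X t ω - X s ω)) = _ at h1
  rw [h3, lintegral_prod _ hg.aemeasurable, h2] at h1
  exact h1.symm

/-- The exponential martingale identity over one step. -/
lemma lintegral_mul_exp_increment (hX : IsStoppedBrownian P 𝓕 T X) {s t : ℝ≥0} (hst : s ≤ t)
    {Y : Ω → ℝ≥0∞} (hY : Measurable[𝓕 s] Y) {ξ : Ω → EuclideanSpace ℝ (Fin m)}
    (hξ : Measurable[𝓕 s] ξ) :
    ∫⁻ ω, Y ω * ENNReal.ofReal (Real.exp (inner ℝ (ξ ω) (X t ω - X s ω)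
      - (min t T - min s T : ℝ≥0) * ‖ξ ω‖ ^ 2 / 2)) ∂P = ∫⁻ ω, Y ω ∂P := by
  have h := hX.lintegral_comp_increment hst (hY.prodMk hξ) (g := fun p w => p.1 *
    ENNReal.ofReal (Real.exp (inner ℝ p.2 w - (min t T - min s T : ℝ≥0) * ‖p.2‖ ^ 2 / 2)))
    (by unfold Function.uncurry; fun_prop)
  refine h.trans (lintegral_congr fun ω => ?_)
  rw [lintegral_const_mul _ (by fun_prop), lintegral_exp_inner_isotropicGaussian, mul_one]

lemma lintegral_sq_inner_increment (hX : IsStoppedBrownian P 𝓕 T X) {s t : ℝ≥0} (hst : s ≤ t)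
    {ξ : Ω → EuclideanSpace ℝ (Fin m)} (hξ : Measurable[𝓕 s] ξ) :
    ∫⁻ ω, ENNReal.ofReal ((inner ℝ (ξ ω) (X t ω - X s ω)) ^ 2) ∂P
      = ∫⁻ ω, ENNReal.ofReal ((min t T - min s T : ℝ≥0) * ‖ξ ω‖ ^ 2) ∂P := by
  have h := hX.lintegral_comp_increment hst hξ
    (g := fun x w => ENNReal.ofReal ((inner ℝ x w) ^ 2)) (by unfold Function.uncurry; fun_prop)
  refine h.trans (lintegral_congr fun ω => ?_)
  rw [lintegral_sq_inner_isotropicGaussian]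

lemma memLp_inner_increment (hX : IsStoppedBrownian P 𝓕 T X) {s t : ℝ≥0} (hst : s ≤ t)
    (hξ : Measurable[𝓕 s] ξ) (hξb : ∃ C : ℝ, ∀ ω, ‖ξ ω‖ ≤ C) :
    MemLp (fun ω => (inner ℝ (ξ ω) (X t ω - X s ω) : ℝ)) 2 P := by
  have hm := (hX.measurable_inner_increment hst hst hξ).mono (𝓕.le t) le_rfl
  obtain ⟨C, hC⟩ := hξb
  rw [memLp_two_iff_integrable_sq hm.aestronglyMeasurable]
  refine ⟨(hm.pow_const 2).aestronglyMeasurable, ?_⟩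
  rw [hasFiniteIntegral_iff_ofReal (ae_of_all _ fun _ => sq_nonneg _),
    hX.lintegral_sq_inner_increment hst hξ]
  calc _ ≤ ∫⁻ _, ENNReal.ofReal ((min t T - min s T : ℝ≥0) * C ^ 2) ∂P := by
        refine lintegral_mono fun ω => ENNReal.ofReal_le_ofReal ?_
        have := hC ω
        gcongr
    _ < ∞ := by rw [lintegral_const, measure_univ, mul_one]; exact ENNReal.ofReal_lt_top

lemma integral_sq_inner_increment (hX : IsStoppedBrownian P 𝓕 T X) {s t : ℝ≥0} (hst : s ≤ t)
    (hξ : Measurable[𝓕 s] ξ) :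
    ∫ ω, (inner ℝ (ξ ω) (X t ω - X s ω)) ^ 2 ∂P
      = (min t T - min s T : ℝ≥0) * ∫ ω, ‖ξ ω‖ ^ 2 ∂P := by
  have hm := (hX.measurable_inner_increment hst hst hξ).mono (𝓕.le t) le_rfl
  have hm' := hξ.mono (𝓕.le s) le_rfl
  rw [integral_eq_lintegral_of_nonneg_ae (ae_of_all _ fun _ => sq_nonneg _)
    (hm.pow_const 2).aestronglyMeasurable, hX.lintegral_sq_inner_increment hst hξ,
    ← integral_const_mul, integral_eq_lintegral_of_nonneg_ae
    (ae_of_all _ fun _ => by positivity) (by fun_prop)]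

/-- Increments are orthogonal to the past. -/
lemma integral_mul_inner_increment (hX : IsStoppedBrownian P 𝓕 T X) {s t : ℝ≥0} (hst : s ≤ t)
    {Y : Ω → ℝ} (hY : Measurable[𝓕 s] Y) (hYp : MemLp Y 2 P)
    (hξ : Measurable[𝓕 s] ξ) (hξb : ∃ C : ℝ, ∀ ω, ‖ξ ω‖ ≤ C) :
    ∫ ω, Y ω * inner ℝ (ξ ω) (X t ω - X s ω) ∂P = 0 := by
  have hint := hYp.integrable_mul (hX.memLp_inner_increment hst hξ hξb)
  have hg : Measurable fun p : (ℝ × EuclideanSpace ℝ (Fin m)) × EuclideanSpace ℝ (Fin m) =>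
    p.1.1 * (inner ℝ p.1.2 p.2 : ℝ) := by fun_prop
  have hpair := hY.prodMk hξ
  have hpair' := hpair.mono (𝓕.le s) le_rfl
  have hall := hpair'.prodMk ((hX.measurable t).sub (hX.measurable s))
  have h1 := integral_map (μ := P) hall.aemeasurable hg.aestronglyMeasurable
  have h2 := hX.map_prodMk hst hpair
  change P.map (fun ω => ((Y ω, ξ ω), (X t - X s) ω)) = _ at h2
  have hint' : Integrable (fun p : (ℝ × EuclideanSpace ℝ (Fin m)) × EuclideanSpace ℝ (Fin m) =>
      p.1.1 * (inner ℝ p.1.2 p.2 : ℝ)) (P.map (fun ω => ((Y ω, ξ ω), (X t - X s) ω))) :=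
    (integrable_map_measure hg.aestronglyMeasurable hall.aemeasurable).2 hint
  refine h1.symm.trans ?_
  rw [h2] at hint' ⊢
  have := Measure.isProbabilityMeasure_map (μ := P) hpair'.aemeasurable
  rw [integral_prod _ hint']
  simp [integral_const_mul, integral_inner_isotropicGaussian]

end IsStoppedBrownian

end TsallisPricing

namespace TsallisPricing

/-! ### Elementary stochastic integrals and the Itô isometry -/

variable {Ω : Type*} {mΩ : MeasurableSpace Ω} {m : ℕ}

/-- `I` is the elementary integral against `X` of the elementary predictable process `f`. -/
inductive IsElementaryIntegral (𝓕 : Filtration ℝ≥0 mΩ) (X : ℝ≥0 → Ω → EuclideanSpace ℝ (Fin m)) :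
    (ℝ≥0 → Ω → EuclideanSpace ℝ (Fin m)) → (Ω → ℝ) → Prop
  | zero : IsElementaryIntegral 𝓕 X (fun _ _ => 0) (fun _ => 0)
  | step {a b : ℝ≥0} {ξ : Ω → EuclideanSpace ℝ (Fin m)} (hab : a ≤ b)
      (hξ : Measurable[𝓕 a] ξ) (hb : ∃ C : ℝ, ∀ ω, ‖ξ ω‖ ≤ C) :
      IsElementaryIntegral 𝓕 X (fun s ω => (Set.Ioc a b).indicator (fun _ => ξ ω) s)
        (fun ω => inner ℝ (ξ ω) (X b ω - X a ω))
  | add {f g : ℝ≥0 → Ω → EuclideanSpace ℝ (Fin m)} {I J : Ω → ℝ}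
      (hf : IsElementaryIntegral 𝓕 X f I) (hg : IsElementaryIntegral 𝓕 X g J) :
      IsElementaryIntegral 𝓕 X (fun s ω => f s ω + g s ω) (fun ω => I ω + J ω)

/-- The measure `P ⊗ dt` on `Ω × (0, T]`. -/
def prodTime (P : Measure Ω) (T : ℝ≥0) : Measure (Ω × ℝ) :=
  P.prod (volume.restrict (Set.Ioc (0 : ℝ) T))

instance (P : Measure Ω) [IsFiniteMeasure P] (T : ℝ≥0) : IsFiniteMeasure (prodTime P T) := by
  unfold prodTime; infer_instance

/-- Links Lebesgue time on `(0, T]` with the stopped clock `min · T` that gives the variance of the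
increments. -/
lemma integral_indicator_Ioc_toNNReal {p q : ℝ≥0} (hpq : p ≤ q) (T : ℝ≥0) :
    ∫ s in Set.Ioc (0 : ℝ) T, (Set.Ioc p q).indicator (fun _ => (1 : ℝ)) s.toNNReal
      = (min q T - min p T : ℝ≥0) := by
  have h1 : ∀ s : ℝ, (Set.Ioc p q).indicator (fun _ => (1 : ℝ)) s.toNNReal
      = (Real.toNNReal ⁻¹' Set.Ioc p q).indicator (fun _ => (1 : ℝ)) s := fun s => rfl
  simp_rw [h1]
  have hm : MeasurableSet (Real.toNNReal ⁻¹' Set.Ioc p q) := measurable_real_toNNReal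
    measurableSet_Ioc
  rw [integral_indicator hm, setIntegral_const, smul_eq_mul, mul_one, measureReal_def,
    Measure.restrict_apply hm]
  have h2 : Real.toNNReal ⁻¹' Set.Ioc p q ∩ Set.Ioc (0 : ℝ) T
      = Set.Ioc ((min p T : ℝ≥0) : ℝ) ((min q T : ℝ≥0) : ℝ) := by
    ext s
    simp only [Set.mem_inter_iff, Set.mem_preimage, Set.mem_Ioc, NNReal.coe_min, min_lt_iff,
      le_min_iff]
    constructor
    · rintro ⟨⟨h3, h4⟩, h5, h6⟩
      lift s to ℝ≥0 using h5.le
      rw [Real.toNNReal_coe] at h3 h4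
      exact ⟨Or.inl (by exact_mod_cast h3), by exact_mod_cast h4, h6⟩
    · rintro ⟨h3, h4, h5⟩
      have h6 : (p : ℝ) < s := h3.resolve_right (not_lt.2 h5)
      have h7 : 0 < s := p.2.trans_lt h6
      lift s to ℝ≥0 using h7.le
      rw [Real.toNNReal_coe]
      exact ⟨⟨by exact_mod_cast h6, by exact_mod_cast h4⟩, h7, h5⟩
  have h3 : min p T ≤ min q T := min_le_min_right T hpq
  rw [h2, Real.volume_Ioc, NNReal.coe_sub h3, ENNReal.toReal_ofReal]
  exact sub_nonneg.2 (by exact_mod_cast h3)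

lemma _root_.MeasureTheory.MemLp.integrable_fun_mul {P : Measure Ω} {f g : Ω → ℝ}
    (hf : MemLp f 2 P) (hg : MemLp g 2 P) : Integrable (fun ω => f ω * g ω) P :=
  hf.integrable_mul hg

namespace IsStoppedBrownian

variable {P : Measure Ω} [IsProbabilityMeasure P] {𝓕 : Filtration ℝ≥0 mΩ} {T : ℝ≥0}
  {X : ℝ≥0 → Ω → EuclideanSpace ℝ (Fin m)} {ξ η : Ω → EuclideanSpace ℝ (Fin m)}

/-- Polarisation of the second-moment identity. -/
lemma integral_mul_increment_same (hX : IsStoppedBrownian P 𝓕 T X) {c b : ℝ≥0} (hcb : c ≤ b)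
    (hξ : Measurable[𝓕 c] ξ) (hξb : ∃ C : ℝ, ∀ ω, ‖ξ ω‖ ≤ C)
    (hη : Measurable[𝓕 c] η) (hηb : ∃ C : ℝ, ∀ ω, ‖η ω‖ ≤ C) :
    ∫ ω, (inner ℝ (ξ ω) (X b ω - X c ω) : ℝ) * inner ℝ (η ω) (X b ω - X c ω) ∂P
      = (min b T - min c T : ℝ≥0) * ∫ ω, inner ℝ (ξ ω) (η ω) ∂P := by
  have hadd : Measurable[𝓕 c] (fun ω => ξ ω + η ω) := hξ.add hη
  have hsub : Measurable[𝓕 c] (fun ω => ξ ω - η ω) := hξ.sub hη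
  obtain ⟨C, hC⟩ := hξb
  obtain ⟨D, hD⟩ := hηb
  have hba : ∃ K : ℝ, ∀ ω, ‖ξ ω + η ω‖ ≤ K :=
    ⟨C + D, fun ω => (norm_add_le _ _).trans (add_le_add (hC ω) (hD ω))⟩
  have hbs : ∃ K : ℝ, ∀ ω, ‖ξ ω - η ω‖ ≤ K :=
    ⟨C + D, fun ω => (norm_sub_le _ _).trans (add_le_add (hC ω) (hD ω))⟩
  have e1 := hX.integral_sq_inner_increment hcb hadd
  have e2 := hX.integral_sq_inner_increment hcb hsub
  have i1 := (hX.memLp_inner_increment hcb hadd hba).integrable_sq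
  have i2 := (hX.memLp_inner_increment hcb hsub hbs).integrable_sq
  have hint : ∀ ζ : Ω → EuclideanSpace ℝ (Fin m), Measurable[𝓕 c] ζ → (∃ K : ℝ, ∀ ω, ‖ζ ω‖ ≤ K) →
      Integrable (fun ω => ‖ζ ω‖ ^ 2) P := by
    rintro ζ hζ ⟨K, hK⟩
    have hζ' := hζ.mono (𝓕.le c) le_rfl
    refine Integrable.of_bound (C := K ^ 2) (by fun_prop) (ae_of_all _ fun ω => ?_)
    rw [Real.norm_of_nonneg (by positivity)]
    exact pow_le_pow_left₀ (norm_nonneg _) (hK ω) 2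
  have p1 : ∀ ω, (inner ℝ (ξ ω) (X b ω - X c ω) : ℝ) * inner ℝ (η ω) (X b ω - X c ω)
      = 1 / 4 * ((inner ℝ (ξ ω + η ω) (X b ω - X c ω)) ^ 2
        - (inner ℝ (ξ ω - η ω) (X b ω - X c ω)) ^ 2) := by
    intro ω
    rw [inner_add_left, inner_sub_left]
    ring
  have p2 : ∀ ω, (inner ℝ (ξ ω) (η ω) : ℝ) = 1 / 4 * (‖ξ ω + η ω‖ ^ 2 - ‖ξ ω - η ω‖ ^ 2) := by
    intro ω
    rw [norm_add_sq_real, norm_sub_sq_real]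
    ring
  simp_rw [p1, p2]
  rw [integral_const_mul, integral_const_mul, integral_sub i1 i2,
    integral_sub (hint _ hadd hba) (hint _ hsub hbs), e1, e2]
  ring

/-- Split the longer increment at `b`: the part after `b` is orthogonal to everything known at `b`.
-/
lemma integral_mul_increment_start_le (hX : IsStoppedBrownian P 𝓕 T X) {c b d : ℝ≥0}
    (hcb : c ≤ b) (hbd : b ≤ d)
    (hξ : Measurable[𝓕 c] ξ) (hξb : ∃ C : ℝ, ∀ ω, ‖ξ ω‖ ≤ C)
    (hη : Measurable[𝓕 c] η) (hηb : ∃ C : ℝ, ∀ ω, ‖η ω‖ ≤ C) :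
    ∫ ω, (inner ℝ (ξ ω) (X b ω - X c ω) : ℝ) * inner ℝ (η ω) (X d ω - X c ω) ∂P
      = (min b T - min c T : ℝ≥0) * ∫ ω, inner ℝ (ξ ω) (η ω) ∂P := by
  have m1 := hX.memLp_inner_increment hcb hξ hξb
  have m2 := hX.memLp_inner_increment hcb hη hηb
  have hη' : Measurable[𝓕 b] η := hη.mono (𝓕.mono hcb) le_rfl
  have m3 := hX.memLp_inner_increment hbd hη' hηb
  have h0 := hX.integral_mul_inner_increment hbd
    (hX.measurable_inner_increment hcb hcb hξ) m1 hη' hηb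
  have h1 := hX.integral_mul_increment_same hcb hξ hξb hη hηb
  have p : ∀ ω, (inner ℝ (ξ ω) (X b ω - X c ω) : ℝ) * inner ℝ (η ω) (X d ω - X c ω)
      = inner ℝ (ξ ω) (X b ω - X c ω) * inner ℝ (η ω) (X b ω - X c ω)
        + inner ℝ (ξ ω) (X b ω - X c ω) * inner ℝ (η ω) (X d ω - X b ω) := by
    intro ω
    rw [← mul_add, ← inner_add_right]
    congr 3
    abel
  simp_rw [p]
  rw [integral_add (m1.integrable_fun_mul m2) (m1.integrable_fun_mul m3), h0, h1, add_zero]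

lemma integral_mul_increment_start (hX : IsStoppedBrownian P 𝓕 T X) {c b d : ℝ≥0}
    (hcb : c ≤ b) (hcd : c ≤ d)
    (hξ : Measurable[𝓕 c] ξ) (hξb : ∃ C : ℝ, ∀ ω, ‖ξ ω‖ ≤ C)
    (hη : Measurable[𝓕 c] η) (hηb : ∃ C : ℝ, ∀ ω, ‖η ω‖ ≤ C) :
    ∫ ω, (inner ℝ (ξ ω) (X b ω - X c ω) : ℝ) * inner ℝ (η ω) (X d ω - X c ω) ∂P
      = (min (min b d) T - min c T : ℝ≥0) * ∫ ω, inner ℝ (ξ ω) (η ω) ∂P := by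
  rcases le_total b d with h | h
  · rw [min_eq_left h]
    exact hX.integral_mul_increment_start_le hcb h hξ hξb hη hηb
  · rw [min_eq_right h]
    have := hX.integral_mul_increment_start_le hcd h hη hηb hξ hξb
    simp_rw [mul_comm (inner ℝ (ξ _) _ : ℝ), this, real_inner_comm]

/-- If `b ≤ c` the intervals are disjoint and both sides vanish. Otherwise the part of the first
increment before `c` is orthogonal to the second increment, and only the overlap `(c, min b d]`
contributes. -/
lemma integral_mul_step_of_le (hX : IsStoppedBrownian P 𝓕 T X) {a b c d : ℝ≥0}
    (hab : a ≤ b) (hcd : c ≤ d) (hac : a ≤ c)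
    (hξ : Measurable[𝓕 a] ξ) (hξb : ∃ C : ℝ, ∀ ω, ‖ξ ω‖ ≤ C)
    (hη : Measurable[𝓕 c] η) (hηb : ∃ C : ℝ, ∀ ω, ‖η ω‖ ≤ C) :
    ∫ ω, (inner ℝ (ξ ω) (X b ω - X a ω) : ℝ) * inner ℝ (η ω) (X d ω - X c ω) ∂P
      = ∫ p, inner ℝ ((Set.Ioc a b).indicator (fun _ => ξ p.1) p.2.toNNReal)
          ((Set.Ioc c d).indicator (fun _ => η p.1) p.2.toNNReal) ∂(prodTime P T) := by
  have hξ' : Measurable[𝓕 c] ξ := hξ.mono (𝓕.mono hac) le_rfl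
  rcases le_or_gt b c with hbc | hcb
  · have m1 := hX.memLp_inner_increment hab hξ hξb
    rw [hX.integral_mul_inner_increment hcd ((hX.measurable_inner_increment hab hab hξ).mono
      (𝓕.mono hbc) le_rfl) m1 hη hηb]
    refine (integral_eq_zero_of_ae (ae_of_all _ fun p => ?_)).symm
    by_cases h : p.2.toNNReal ∈ Set.Ioc a b
    · have : p.2.toNNReal ∉ Set.Ioc c d := fun h' => (h.2.trans hbc).not_gt h'.1
      simp [Set.indicator_of_notMem this]
    · simp [Set.indicator_of_notMem h]
  · have m1 := hX.memLp_inner_increment hac hξ hξb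
    have m2 := hX.memLp_inner_increment hcb.le hξ' hξb
    have m3 := hX.memLp_inner_increment hcd hη hηb
    have h0 := hX.integral_mul_inner_increment hcd
      (hX.measurable_inner_increment hac hac hξ) m1 hη hηb
    have h1 := hX.integral_mul_increment_start hcb.le hcd hξ' hξb hη hηb
    have p : ∀ ω, (inner ℝ (ξ ω) (X b ω - X a ω) : ℝ) * inner ℝ (η ω) (X d ω - X c ω)
        = inner ℝ (ξ ω) (X c ω - X a ω) * inner ℝ (η ω) (X d ω - X c ω)
          + inner ℝ (ξ ω) (X b ω - X c ω) * inner ℝ (η ω) (X d ω - X c ω) := by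
      intro ω
      rw [← add_mul, ← inner_add_right]
      congr 3
      abel
    have q : ∀ p : Ω × ℝ, (inner ℝ ((Set.Ioc a b).indicator (fun _ => ξ p.1) p.2.toNNReal)
        ((Set.Ioc c d).indicator (fun _ => η p.1) p.2.toNNReal) : ℝ)
        = inner ℝ (ξ p.1) (η p.1)
          * (Set.Ioc c (min b d)).indicator (fun _ => (1 : ℝ)) p.2.toNNReal := by
      intro p
      by_cases h : p.2.toNNReal ∈ Set.Ioc c d
      · by_cases h' : p.2.toNNReal ≤ b
        · have e1 : p.2.toNNReal ∈ Set.Ioc a b := ⟨hac.trans_lt h.1, h'⟩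
          have e2 : p.2.toNNReal ∈ Set.Ioc c (min b d) := ⟨h.1, le_min h' h.2⟩
          simp only [Set.indicator_of_mem h, Set.indicator_of_mem e1, Set.indicator_of_mem e2,
            mul_one]
        · have e1 : p.2.toNNReal ∉ Set.Ioc a b := fun e => h' e.2
          have e2 : p.2.toNNReal ∉ Set.Ioc c (min b d) := fun e => h' (e.2.trans (min_le_left _ _))
          simp only [Set.indicator_of_notMem e1, Set.indicator_of_notMem e2, mul_zero,
            inner_zero_left]
      · have e2 : p.2.toNNReal ∉ Set.Ioc c (min b d) :=
          fun e => h ⟨e.1, e.2.trans (min_le_right _ _)⟩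
        simp only [Set.indicator_of_notMem h, Set.indicator_of_notMem e2, mul_zero,
            inner_zero_right]
    simp_rw [p, q]
    rw [integral_add (m1.integrable_fun_mul m3) (m2.integrable_fun_mul m3), h0, h1, zero_add, prodTime,
      integral_prod_mul (fun ω => (inner ℝ (ξ ω) (η ω) : ℝ))
        (fun s : ℝ => (Set.Ioc c (min b d)).indicator (fun _ => (1 : ℝ)) s.toNNReal),
      integral_indicator_Ioc_toNNReal (le_min hcb.le hcd), mul_comm]

end IsStoppedBrownian

namespace IsElementaryIntegral

variable {P : Measure Ω} {𝓕 : Filtration ℝ≥0 mΩ} {T : ℝ≥0}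
  {X f g : ℝ≥0 → Ω → EuclideanSpace ℝ (Fin m)} {I J : Ω → ℝ}

lemma neg (hf : IsElementaryIntegral 𝓕 X f I) :
    IsElementaryIntegral 𝓕 X (fun s ω => -f s ω) (fun ω => -I ω) := by
  induction hf with
  | zero => simpa using zero
  | @step a b ξ hab hξ hb =>
    have hξ' : Measurable[𝓕 a] (fun ω => -ξ ω) := hξ.neg
    convert step (X := X) hab hξ' (by simpa using hb) using 3
    · simp only [Set.indicator]
      split_ifs <;> simp
    · rw [inner_neg_left]
  | add _ _ h1 h2 => convert add h1 h2 using 3 <;> exact neg_add _ _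

/-- The reason for the inductive class: simple integrands on different grids can be subtracted
without a common refinement. -/
lemma sub (hf : IsElementaryIntegral 𝓕 X f I) (hg : IsElementaryIntegral 𝓕 X g J) :
    IsElementaryIntegral 𝓕 X (fun s ω => f s ω - g s ω) (fun ω => I ω - J ω) := by
  simpa only [sub_eq_add_neg] using add hf hg.neg

lemma sum_range {F : ℕ → ℝ≥0 → Ω → EuclideanSpace ℝ (Fin m)} {K : ℕ → Ω → ℝ}
    (h : ∀ j, IsElementaryIntegral 𝓕 X (F j) (K j)) (N : ℕ) :
    IsElementaryIntegral 𝓕 X (fun s ω => ∑ j ∈ Finset.range N, F j s ω)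
      (fun ω => ∑ j ∈ Finset.range N, K j ω) := by
  induction N with
  | zero => simpa using zero
  | succ N ih => simpa only [Finset.sum_range_succ] using add ih (h N)

lemma measurable_process (hf : IsElementaryIntegral 𝓕 X f I) :
    Measurable (fun p : Ω × ℝ => f p.2.toNNReal p.1) := by
  induction hf with
  | zero => exact measurable_const
  | @step a b ξ hab hξ hb =>
    have hξ' := hξ.mono (𝓕.le a) le_rfl
    have : MeasurableSet {p : Ω × ℝ | p.2.toNNReal ∈ Set.Ioc a b} :=
      (measurable_real_toNNReal.comp measurable_snd) measurableSet_Ioc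
    exact (hξ'.comp measurable_fst).indicator this
  | add _ _ h1 h2 => exact h1.add h2

lemma bounded (hf : IsElementaryIntegral 𝓕 X f I) : ∃ C : ℝ, ∀ s ω, ‖f s ω‖ ≤ C := by
  induction hf with
  | zero => exact ⟨0, by simp⟩
  | @step a b ξ hab hξ hb =>
    obtain ⟨C, hC⟩ := hb
    exact ⟨C, fun s ω => (norm_indicator_le_norm_self (fun _ => ξ ω) s).trans (hC ω)⟩
  | add _ _ h1 h2 =>
    obtain ⟨C, hC⟩ := h1
    obtain ⟨D, hD⟩ := h2
    exact ⟨C + D, fun s ω => (norm_add_le _ _).trans (add_le_add (hC s ω) (hD s ω))⟩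

variable [IsProbabilityMeasure P]

lemma memLp (hf : IsElementaryIntegral 𝓕 X f I) (hX : IsStoppedBrownian P 𝓕 T X) :
    MemLp I 2 P := by
  induction hf with
  | zero => exact MemLp.zero
  | step hab hξ hb => exact hX.memLp_inner_increment hab hξ hb
  | add _ _ h1 h2 => exact h1.add h2

lemma integrable_inner (hf : IsElementaryIntegral 𝓕 X f I) (hg : IsElementaryIntegral 𝓕 X g J) :
    Integrable (fun p : Ω × ℝ => (inner ℝ (f p.2.toNNReal p.1) (g p.2.toNNReal p.1) : ℝ))
      (prodTime P T) := by
  obtain ⟨C, hC⟩ := hf.bounded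
  obtain ⟨D, hD⟩ := hg.bounded
  refine Integrable.of_bound (C := C * D)
    (hf.measurable_process.inner hg.measurable_process).aestronglyMeasurable
    (ae_of_all _ fun p => ?_)
  exact (norm_inner_le_norm _ _).trans (mul_le_mul (hC _ _) (hD _ _) (norm_nonneg _)
    ((norm_nonneg _).trans (hC 0 p.1)))

/-- Both sides are bilinear, so a double induction leaves only two single steps, which may be
ordered by starting time. -/
lemma integral_mul (hf : IsElementaryIntegral 𝓕 X f I) (hg : IsElementaryIntegral 𝓕 X g J)
    (hX : IsStoppedBrownian P 𝓕 T X) :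
    ∫ ω, I ω * J ω ∂P
      = ∫ p, inner ℝ (f p.2.toNNReal p.1) (g p.2.toNNReal p.1) ∂(prodTime P T) := by
  induction hf with
  | zero => simp
  | add hf₁ hf₂ h1 h2 =>
    simp_rw [add_mul, inner_add_left]
    rw [integral_add ((hf₁.memLp hX).integrable_fun_mul (hg.memLp hX))
      ((hf₂.memLp hX).integrable_fun_mul (hg.memLp hX)), h1, h2,
      integral_add (hf₁.integrable_inner hg) (hf₂.integrable_inner hg)]
  | @step a b ξ hab hξ hb =>
    have hf := step (X := X) hab hξ hb
    induction hg with
    | zero => simp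
    | add hg₁ hg₂ h1 h2 =>
      simp_rw [mul_add, inner_add_right]
      rw [integral_add ((hf.memLp hX).integrable_fun_mul (hg₁.memLp hX))
        ((hf.memLp hX).integrable_fun_mul (hg₂.memLp hX)), h1, h2,
        integral_add (hf.integrable_inner hg₁) (hf.integrable_inner hg₂)]
    | @step c d η hcd hη hb' =>
      rcases le_total a c with hac | hca
      · exact hX.integral_mul_step_of_le hab hcd hac hξ hb hη hb'
      · have := hX.integral_mul_step_of_le hcd hab hca hη hb' hξ hb
        simp_rw [mul_comm (inner ℝ (η _) _ : ℝ)] at this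
        rw [this]
        exact integral_congr_ae (ae_of_all _ fun p => real_inner_comm _ _)

/-- The Itô isometry. -/
lemma lintegral_sq (hf : IsElementaryIntegral 𝓕 X f I) (hX : IsStoppedBrownian P 𝓕 T X) :
    ∫⁻ ω, ‖I ω‖ₑ ^ 2 ∂P = ∫⁻ ω, (∫⁻ s in Set.Ioc (0 : ℝ) T, ‖f s.toNNReal ω‖ₑ ^ 2) ∂P := by
  have h := hf.integral_mul hf hX
  have hm := hf.measurable_process
  have h1 : ∀ r : ℝ, ‖r‖ₑ ^ 2 = ENNReal.ofReal (r * r) := fun r => by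
    rw [Real.enorm_eq_ofReal_abs, ← ENNReal.ofReal_pow (abs_nonneg r), sq_abs, sq]
  have h2 : ∀ x : EuclideanSpace ℝ (Fin m), ‖x‖ₑ ^ 2 = ENNReal.ofReal (inner ℝ x x) := fun x => by
    rw [← ofReal_norm, ← ENNReal.ofReal_pow (norm_nonneg x),
      real_inner_self_eq_norm_sq]
  rw [← lintegral_prod (fun p : Ω × ℝ => ‖f p.2.toNNReal p.1‖ₑ ^ 2)
    (hm.enorm.pow_const 2).aemeasurable]
  simp_rw [h1, h2]
  rw [← ofReal_integral_eq_lintegral_ofReal ((hf.memLp hX).integrable_fun_mul (hf.memLp hX))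
    (ae_of_all _ fun _ => mul_self_nonneg _), h, ofReal_integral_eq_lintegral_ofReal
    (hf.integrable_inner hf) (ae_of_all _ fun _ => real_inner_self_nonneg)]
  rfl

end IsElementaryIntegral

end TsallisPricing

namespace TsallisPricing

/-! ### Mean-square limits of elementary integrals -/

section MeanSquare

variable {α E : Type*} [MeasurableSpace α] [NormedAddCommGroup E] {μ : Measure α}

lemma lintegral_enorm_sq_eq (f : α → E) : ∫⁻ x, ‖f x‖ₑ ^ 2 ∂μ = eLpNorm f 2 μ ^ 2 := by
  have h := eLpNorm_nnreal_pow_eq_lintegral (μ := μ) (f := f) (p := 2) two_ne_zero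
  simpa using h.symm

lemma tendsto_pow_two_zero_iff {u : ℕ → ℝ≥0∞} :
    Tendsto (fun k => u k ^ 2) atTop (𝓝 0) ↔ Tendsto u atTop (𝓝 0) := by
  constructor
  · intro h
    have h1 := (ENNReal.continuous_rpow_const (y := (1 / 2 : ℝ))).tendsto 0 |>.comp h
    have h2 : (fun x : ℝ≥0∞ => x ^ (1 / 2 : ℝ)) ∘ (fun k => u k ^ 2) = u := by
      funext k
      simp only [Function.comp]
      rw [← ENNReal.rpow_two, ← ENNReal.rpow_mul]
      norm_num
    rw [h2] at h1
    simpa using h1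
  · intro h
    have h1 := (ENNReal.continuous_pow 2).tendsto 0 |>.comp h
    simpa [Function.comp_def] using h1

lemma tendsto_lintegral_enorm_sq_iff {f : ℕ → α → E} :
    Tendsto (fun k => ∫⁻ x, ‖f k x‖ₑ ^ 2 ∂μ) atTop (𝓝 0) ↔
      Tendsto (fun k => eLpNorm (f k) 2 μ) atTop (𝓝 0) := by
  simp_rw [lintegral_enorm_sq_eq]
  exact tendsto_pow_two_zero_iff

lemma eLpNorm_sub_le_add {f g h : α → E} (hf : AEStronglyMeasurable f μ)
    (hg : AEStronglyMeasurable g μ) (hh : AEStronglyMeasurable h μ) :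
    eLpNorm (f - g) 2 μ ≤ eLpNorm (f - h) 2 μ + eLpNorm (g - h) 2 μ := by
  have : f - g = (f - h) - (g - h) := by abel
  rw [this]
  exact eLpNorm_sub_le (hf.sub hh) (hg.sub hh) (by norm_num)

end MeanSquare

variable {Ω : Type*} {mΩ : MeasurableSpace Ω} {m : ℕ}

/-- A process seen as a function on `Ω × ℝ`. -/
def onStrip (f : ℝ≥0 → Ω → EuclideanSpace ℝ (Fin m)) (p : Ω × ℝ) : EuclideanSpace ℝ (Fin m) :=
  f p.2.toNNReal p.1

lemma IsElementaryIntegral.eLpNorm_eq {P : Measure Ω} [IsProbabilityMeasure P]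
    {𝓕 : Filtration ℝ≥0 mΩ} {T : ℝ≥0} {X f : ℝ≥0 → Ω → EuclideanSpace ℝ (Fin m)} {I : Ω → ℝ}
    (hf : IsElementaryIntegral 𝓕 X f I) (hX : IsStoppedBrownian P 𝓕 T X) :
    eLpNorm I 2 P = eLpNorm (onStrip f) 2 (prodTime P T) := by
  have h := hf.lintegral_sq hX
  rw [← lintegral_prod (fun p : Ω × ℝ => ‖f p.2.toNNReal p.1‖ₑ ^ 2)
    (hf.measurable_process.enorm.pow_const 2).aemeasurable] at h
  have h2 := lintegral_enorm_sq_eq (μ := prodTime P T) (onStrip f)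
  rw [lintegral_enorm_sq_eq] at h
  have h3 : eLpNorm I 2 P ^ 2 = eLpNorm (onStrip f) 2 (prodTime P T) ^ 2 := h.trans h2
  exact (ENNReal.pow_right_strictMono two_ne_zero).injective h3

/-- `I` is a mean-square limit of elementary integrals whose integrands converge to `f` in
`L²(P ⊗ dt)`. -/
structure IsItoLimit (P : Measure Ω) (𝓕 : Filtration ℝ≥0 mΩ) (T : ℝ≥0)
    (X f : ℝ≥0 → Ω → EuclideanSpace ℝ (Fin m)) (I : Ω → ℝ) : Prop where
  process : AEStronglyMeasurable (onStrip f) (prodTime P T)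
  measurable_limit : AEStronglyMeasurable I P
  exists_seq : ∃ (F : ℕ → ℝ≥0 → Ω → EuclideanSpace ℝ (Fin m)) (K : ℕ → Ω → ℝ),
    (∀ k, IsElementaryIntegral 𝓕 X (F k) (K k)) ∧
    Tendsto (fun k => eLpNorm (onStrip (F k) - onStrip f) 2 (prodTime P T)) atTop (𝓝 0) ∧
    Tendsto (fun k => eLpNorm (K k - I) 2 P) atTop (𝓝 0)

namespace IsItoLimit

variable {P : Measure Ω} [IsProbabilityMeasure P] {𝓕 : Filtration ℝ≥0 mΩ} {T : ℝ≥0}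
  {X f g : ℝ≥0 → Ω → EuclideanSpace ℝ (Fin m)} {I J : Ω → ℝ}

/-- Used to subtract a single step from the drift while keeping its integral explicit. -/
lemma sub_elementary (hf : IsItoLimit P 𝓕 T X f I) (hg : IsElementaryIntegral 𝓕 X g J)
    (hX : IsStoppedBrownian P 𝓕 T X) :
    IsItoLimit P 𝓕 T X (fun s ω => f s ω - g s ω) (fun ω => I ω - J ω) := by
  obtain ⟨h1, h2, F, K, hFK, hF, hK⟩ := hf
  refine ⟨h1.sub hg.measurable_process.aestronglyMeasurable, h2.sub (hg.memLp hX).1,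
    fun k s ω => F k s ω - g s ω, fun k ω => K k ω - J ω, fun k => (hFK k).sub hg, ?_, ?_⟩
  · convert hF using 3 with k
    funext p
    simp [onStrip]
  · convert hK using 3 with k
    funext p
    simp

/-- A mean-square limit of elementary integrals is controlled by any other sequence of
elementary integrals with the same limit integrand. -/
lemma tendsto_of_tendsto (hf : IsItoLimit P 𝓕 T X f I) (hX : IsStoppedBrownian P 𝓕 T X)
    {G : ℕ → ℝ≥0 → Ω → EuclideanSpace ℝ (Fin m)} {L : ℕ → Ω → ℝ}
    (hGL : ∀ k, IsElementaryIntegral 𝓕 X (G k) (L k))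
    (hG : Tendsto (fun k => eLpNorm (onStrip (G k) - onStrip f) 2 (prodTime P T)) atTop (𝓝 0)) :
    Tendsto (fun k => eLpNorm (L k - I) 2 P) atTop (𝓝 0) := by
  obtain ⟨h1, h2, F, K, hFK, hF, hK⟩ := hf
  -- Triangle inequality through `K k`; the isometry turns `L k - K k` into a difference of
  -- integrands, both close to `f`.
  have hle : ∀ k, eLpNorm (L k - I) 2 P
      ≤ (eLpNorm (onStrip (G k) - onStrip f) 2 (prodTime P T)
        + eLpNorm (onStrip (F k) - onStrip f) 2 (prodTime P T)) + eLpNorm (K k - I) 2 P := by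
    intro k
    have e1 : L k - I = (L k - K k) + (K k - I) := by abel
    have e2 : eLpNorm (L k - K k) 2 P
        = eLpNorm (onStrip (G k) - onStrip (F k)) 2 (prodTime P T) :=
      ((hGL k).sub (hFK k)).eLpNorm_eq hX
    have e3 := eLpNorm_sub_le_add (μ := prodTime P T)
      (hGL k).measurable_process.aestronglyMeasurable
      (hFK k).measurable_process.aestronglyMeasurable h1
    rw [e1]
    refine (eLpNorm_add_le (((hGL k).memLp hX).1.sub ((hFK k).memLp hX).1)
      (((hFK k).memLp hX).1.sub h2) (by norm_num)).trans ?_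
    rw [e2]
    gcongr
    exact e3
  refine tendsto_of_tendsto_of_tendsto_of_le_of_le tendsto_const_nhds ?_ (fun _ => zero_le) hle
  simpa using (hG.add hF).add hK

end IsItoLimit

/-! ### Simple integrands -/

namespace SimpleIntegrand

variable {𝓕 : Filtration ℝ≥0 mΩ} (φ : SimpleIntegrand 𝓕 m)

lemma toFun_eq_val {s : ℝ≥0} {j : ℕ} (hj : j < φ.N) (hs : s ∈ Set.Ioc (φ.time j) (φ.time (j + 1)))
    (ω : Ω) : φ.toFun s ω = φ.val j ω := by
  rw [SimpleIntegrand.toFun, Finset.sum_eq_single_of_mem j (Finset.mem_range.2 hj),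
    Set.indicator_of_mem hs]
  intro i _ hij
  refine Set.indicator_of_notMem (fun hi => ?_) _
  rcases lt_or_gt_of_ne hij with h | h
  · exact (hi.2.trans (φ.mono h)).not_gt hs.1
  · exact (hs.2.trans (φ.mono h)).not_gt hi.1

lemma toFun_cases (s : ℝ≥0) :
    (∃ j < φ.N, s ∈ Set.Ioc (φ.time j) (φ.time (j + 1))) ∨
      ∀ j < φ.N, s ∉ Set.Ioc (φ.time j) (φ.time (j + 1)) := by
  by_cases h : ∃ j < φ.N, s ∈ Set.Ioc (φ.time j) (φ.time (j + 1))
  · exact Or.inl h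
  · push Not at h
    exact Or.inr h

lemma toFun_eq_zero {s : ℝ≥0} (h : ∀ j < φ.N, s ∉ Set.Ioc (φ.time j) (φ.time (j + 1))) (ω : Ω) :
    φ.toFun s ω = 0 :=
  Finset.sum_eq_zero fun j hj => Set.indicator_of_notMem (h j (Finset.mem_range.1 hj)) _

lemma norm_toFun_le {C : ℝ} (hC : 0 ≤ C) (h : ∀ j ω, ‖φ.val j ω‖ ≤ C) (s : ℝ≥0) (ω : Ω) :
    ‖φ.toFun s ω‖ ≤ C := by
  rcases φ.toFun_cases s with ⟨j, hj, hs⟩ | hs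
  · rw [φ.toFun_eq_val hj hs]
    exact h j ω
  · rwa [φ.toFun_eq_zero hs, norm_zero]

/-- No cross terms appear: monotone times make the intervals disjoint, so at most one summand is
nonzero at each time. -/
lemma norm_sq_toFun (s : ℝ≥0) (ω : Ω) :
    ‖φ.toFun s ω‖ ^ 2 = ∑ j ∈ Finset.range φ.N,
      ‖φ.val j ω‖ ^ 2 * (Set.Ioc (φ.time j) (φ.time (j + 1))).indicator (fun _ => (1 : ℝ)) s := by
  rcases φ.toFun_cases s with ⟨j, hj, hs⟩ | hs
  · rw [φ.toFun_eq_val hj hs, Finset.sum_eq_single_of_mem j (Finset.mem_range.2 hj),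
      Set.indicator_of_mem hs, mul_one]
    intro i _ hij
    rw [Set.indicator_of_notMem, mul_zero]
    intro hi
    rcases lt_or_gt_of_ne hij with h | h
    · exact (hi.2.trans (φ.mono h)).not_gt hs.1
    · exact (hs.2.trans (φ.mono h)).not_gt hi.1
  · rw [φ.toFun_eq_zero hs, norm_zero, Finset.sum_eq_zero]
    · norm_num
    · intro j hj
      rw [Set.indicator_of_notMem (hs j (Finset.mem_range.1 hj)), mul_zero]

lemma integral_norm_sq_toFun (T : ℝ≥0) (ω : Ω) :
    ∫ s in (0 : ℝ)..T, ‖φ.toFun s.toNNReal ω‖ ^ 2 = ∑ j ∈ Finset.range φ.N,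
      (min (φ.time (j + 1)) T - min (φ.time j) T : ℝ≥0) * ‖φ.val j ω‖ ^ 2 := by
  rw [intervalIntegral.integral_of_le T.coe_nonneg]
  simp_rw [φ.norm_sq_toFun]
  rw [integral_finsetSum]
  · refine Finset.sum_congr rfl fun j _ => ?_
    rw [integral_const_mul, integral_indicator_Ioc_toNNReal (φ.mono j.le_succ), mul_comm]
  · intro j _
    refine Integrable.const_mul ?_ _
    refine Integrable.of_bound (C := 1) ?_ (ae_of_all _ fun s => ?_)
    · exact ((measurable_const.indicator measurableSet_Ioc).comp
        measurable_real_toNNReal).aestronglyMeasurable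
    · exact (norm_indicator_le_norm_self (fun _ => (1 : ℝ)) _).trans (by simp)

lemma isElementaryIntegral (T : ℝ≥0) (W : ℝ≥0 → Ω → EuclideanSpace ℝ (Fin m)) :
    IsElementaryIntegral 𝓕 (fun s => W (min s T)) φ.toFun (φ.integral T W) :=
  .sum_range (F := fun j s ω => (Set.Ioc (φ.time j) (φ.time (j + 1))).indicator
      (fun _ => φ.val j ω) s)
    (K := fun j ω => inner ℝ (φ.val j ω)
      (W (min (φ.time (j + 1)) T) ω - W (min (φ.time j) T) ω))
    (fun j => .step (X := fun s => W (min s T)) (φ.mono j.le_succ) (φ.meas j).measurable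
      ((φ.bdd).imp fun _ h => h j)) φ.N

end SimpleIntegrand

variable {P : Measure Ω} {𝓕 : Filtration ℝ≥0 mΩ} {T : ℝ≥0}
  {W H : ℝ≥0 → Ω → EuclideanSpace ℝ (Fin m)} {I : Ω → ℝ}

lemma tendsto_strip_iff {F : ℕ → ℝ≥0 → Ω → EuclideanSpace ℝ (Fin m)}
    (hF : ∀ k, AEStronglyMeasurable (onStrip (F k)) (prodTime P T))
    (hH : AEStronglyMeasurable (onStrip H) (prodTime P T)) :
    Tendsto (fun k => ∫⁻ ω, (∫⁻ s in Set.Ioc (0 : ℝ) T,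
      ‖F k s.toNNReal ω - H s.toNNReal ω‖ₑ ^ 2) ∂P) atTop (𝓝 0) ↔
    Tendsto (fun k => eLpNorm (onStrip (F k) - onStrip H) 2 (prodTime P T)) atTop (𝓝 0) := by
  rw [← tendsto_lintegral_enorm_sq_iff]
  refine tendsto_congr fun k => ?_
  rw [prodTime, lintegral_prod _ (((hF k).sub hH).enorm.pow_const 2)]
  rfl

lemma IsItoIntegral.isItoLimit (hI : IsItoIntegral P 𝓕 T W H I)
    (hH : AEStronglyMeasurable (onStrip H) (prodTime P T)) :
    IsItoLimit P 𝓕 T (fun s => W (min s T)) H I := by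
  obtain ⟨h1, φ, h2, h3⟩ := hI
  refine ⟨hH, h1.1, fun k => (φ k).toFun, fun k => (φ k).integral T W,
    fun k => (φ k).isElementaryIntegral T W, ?_, tendsto_lintegral_enorm_sq_iff.1 h3⟩
  exact (tendsto_strip_iff (fun k => ((φ k).isElementaryIntegral T
    W).measurable_process.aestronglyMeasurable) hH).1 h2

variable [IsProbabilityMeasure P]

/-- By the isometry the elementary integrals are Cauchy in `L²(P)`; completeness supplies the limit.
-/
lemma exists_isItoIntegral (hX : IsStoppedBrownian P 𝓕 T (fun s => W (min s T)))
    (hH : AEStronglyMeasurable (onStrip H) (prodTime P T)) (φ : ℕ → SimpleIntegrand 𝓕 m)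
    (hφ : Tendsto (fun k => eLpNorm (onStrip (φ k).toFun - onStrip H) 2 (prodTime P T))
      atTop (𝓝 0)) :
    ∃ I, IsItoIntegral P 𝓕 T W H I := by
  have hel := fun k => (φ k).isElementaryIntegral T W
  have hmem := fun k => (hel k).memLp hX
  have hms := fun k => (hel k).measurable_process.aestronglyMeasurable (μ := prodTime P T)
  have hcau : CauchySeq fun k => (hmem k).toLp ((φ k).integral T W) := by
    rw [EMetric.cauchySeq_iff]
    intro ε hε
    have hev := hφ.eventually (gt_mem_nhds (ENNReal.half_pos hε.ne'))
    obtain ⟨N, hN⟩ := eventually_atTop.1 hev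
    refine ⟨N, fun k hk l hl => ?_⟩
    rw [Lp.edist_toLp_toLp]
    have e := ((hel k).sub (hel l)).eLpNorm_eq hX
    calc eLpNorm ((φ k).integral T W - (φ l).integral T W) 2 P
        = eLpNorm (onStrip (φ k).toFun - onStrip (φ l).toFun) 2 (prodTime P T) := e
      _ ≤ _ := eLpNorm_sub_le_add (hms k) (hms l) hH
      _ < ε / 2 + ε / 2 := ENNReal.add_lt_add (hN k hk) (hN l hl)
      _ = ε := ENNReal.add_halves ε
  obtain ⟨L, hL⟩ := cauchySeq_tendsto_of_complete hcau
  refine ⟨L, Lp.memLp L, φ, (tendsto_strip_iff hms hH).2 hφ, ?_⟩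
  refine tendsto_lintegral_enorm_sq_iff.2 ?_
  have h1 := (Lp.tendsto_Lp_iff_tendsto_eLpNorm' _ _).1 hL
  refine h1.congr fun k => eLpNorm_congr_ae ?_
  filter_upwards [(hmem k).coeFn_toLp] with ω hω
  simp [hω]

end TsallisPricing

namespace TsallisPricing

/-! ### Approximation of bounded predictable processes by simple integrands -/

variable {Ω : Type*} {mΩ : MeasurableSpace Ω} {m : ℕ} {𝓕 : Filtration ℝ≥0 mΩ}
  {ψ : ℝ≥0 → Ω → EuclideanSpace ℝ (Fin m)}

lemma predictable_mono {𝓖 : Filtration ℝ≥0 mΩ} (h : ∀ t, 𝓖 t ≤ 𝓕 t) :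
    𝓖.predictable ≤ 𝓕.predictable :=
  measurableSpace_le_predictable_of_measurableSet
    (fun A hA => measurableSet_predictable_singleton_bot_prod (h _ A hA))
    (fun _ A hA => measurableSet_predictable_Ioi_prod (h _ A hA))

lemma predictable_le_prod : 𝓕.predictable ≤ (inferInstance : MeasurableSpace (ℝ≥0 × Ω)) :=
  measurableSpace_le_predictable_of_measurableSet
    (fun A hA => (measurableSet_singleton _).prod (𝓕.le _ A hA))
    (fun _ A hA => measurableSet_Ioi.prod (𝓕.le _ A hA))

lemma stronglyMeasurable_onStrip (hψ : IsStronglyPredictable 𝓕 ψ) :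
    StronglyMeasurable (onStrip ψ) := by
  have h1 : StronglyMeasurable (Function.uncurry ψ) := StronglyMeasurable.mono hψ predictable_le_prod
  exact h1.comp_measurable (g := fun p : Ω × ℝ => (p.2.toNNReal, p.1)) (by fun_prop)

lemma stronglyMeasurable_section (hψ : IsStronglyPredictable 𝓕 ψ) (ω : Ω) :
    StronglyMeasurable (fun s : ℝ => ψ s.toNNReal ω) :=
  (stronglyMeasurable_onStrip hψ).comp_measurable (g := fun s : ℝ => (ω, s)) (by fun_prop)

lemma stronglyMeasurable_integral_of_prod {Ω : Type*} {mΩ : MeasurableSpace Ω}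
    {f : Ω × ℝ → EuclideanSpace ℝ (Fin m)} (hf : StronglyMeasurable f) (ν : Measure ℝ) [SFinite ν] :
    StronglyMeasurable fun ω => ∫ u, f (ω, u) ∂ν :=
  hf.integral_prod_right'

/-- A predictable process is progressive, so once time is clipped at `b` it is jointly measurable
for `𝓕 b`, and Fubini keeps this measurability. -/
lemma stronglyMeasurable_integral_min (hψ : IsStronglyPredictable 𝓕 ψ) (b : ℝ≥0) (ν : Measure ℝ)
    [SFinite ν] : StronglyMeasurable[𝓕 b] fun ω => ∫ u, ψ (min u.toNNReal b) ω ∂ν := by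
  have h1 := hψ.isStronglyProgressive b
  have h2 : Measurable[(𝓕 b).prod inferInstance, Subtype.instMeasurableSpace.prod (𝓕 b)]
      (fun p : Ω × ℝ => ((⟨min p.2.toNNReal b, Set.mem_Iic.2 (min_le_right _ _)⟩ : Set.Iic b), p.1)) := by
    refine Measurable.prodMk (Measurable.subtype_mk ?_) ?_
    · exact (measurable_real_toNNReal.comp (@measurable_snd Ω ℝ (𝓕 b) _)).min measurable_const
    · exact @measurable_fst Ω ℝ (𝓕 b) _
  exact stronglyMeasurable_integral_of_prod (mΩ := 𝓕 b) (h1.comp_measurable h2) ν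

/-- The average of `ψ` over the dyadic interval of order `k` ending at `j / 2 ^ k`. -/
def dyadicAverage (ψ : ℝ≥0 → Ω → EuclideanSpace ℝ (Fin m)) (k j : ℕ) (ω : Ω) :
    EuclideanSpace ℝ (Fin m) :=
  -- A closed ball instead of a half-open interval, to match the Lebesgue differentiation theorem.
  -- For `j = 0` the ball lies in `(-∞, 0]`, where `Real.toNNReal` is zero, and the average is `ψ 0
  -- ω`.
  ⨍ u in Metric.closedBall (((j : ℝ) - 1 / 2) / 2 ^ k) (1 / 2 / 2 ^ k), ψ u.toNNReal ω

lemma norm_dyadicAverage_le {C : ℝ} (hC : ∀ s ω, ‖ψ s ω‖ ≤ C) (k j : ℕ) (ω : Ω) :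
    ‖dyadicAverage ψ k j ω‖ ≤ C := by
  have hpos : (0 : ℝ) < 1 / 2 / 2 ^ k := by positivity
  have : IsProbabilityMeasure ((volume.restrict (Metric.closedBall (((j : ℝ) - 1 / 2) / 2 ^ k)
      (1 / 2 / 2 ^ k)) Set.univ)⁻¹ • volume.restrict (Metric.closedBall (((j : ℝ) - 1 / 2) / 2 ^ k)
      (1 / 2 / 2 ^ k))) := by
    refine ⟨?_⟩
    rw [Measure.smul_apply, smul_eq_mul, Measure.restrict_apply_univ]
    exact ENNReal.inv_mul_cancel (Metric.measure_closedBall_pos volume _ hpos).ne'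
      measure_closedBall_lt_top.ne
  have h := norm_integral_le_of_norm_le_const (μ := (volume.restrict (Metric.closedBall
      (((j : ℝ) - 1 / 2) / 2 ^ k) (1 / 2 / 2 ^ k)) Set.univ)⁻¹ • volume.restrict
      (Metric.closedBall (((j : ℝ) - 1 / 2) / 2 ^ k) (1 / 2 / 2 ^ k)))
      (f := fun u : ℝ => ψ u.toNNReal ω) (ae_of_all _ fun u => hC u.toNNReal ω)
  rwa [probReal_univ, mul_one] at h

/-- The averaging interval ends at `j / 2 ^ k`, so clipping time there changes nothing. Averaging
over the preceding interval is what makes the approximation adapted. -/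
lemma stronglyMeasurable_dyadicAverage (hψ : IsStronglyPredictable 𝓕 ψ) (k j : ℕ) :
    StronglyMeasurable[𝓕 (j / 2 ^ k)] (dyadicAverage ψ k j) := by
  have h1 : dyadicAverage ψ k j = fun ω => (volume.real (Metric.closedBall
      (((j : ℝ) - 1 / 2) / 2 ^ k) (1 / 2 / 2 ^ k)))⁻¹ • ∫ u in Metric.closedBall
      (((j : ℝ) - 1 / 2) / 2 ^ k) (1 / 2 / 2 ^ k), ψ (min u.toNNReal (j / 2 ^ k)) ω := by
    funext ω
    rw [dyadicAverage, setAverage_eq]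
    congr 1
    refine setIntegral_congr_fun measurableSet_closedBall fun u hu => ?_
    have h2 : u ≤ j / 2 ^ k := by
      rw [Real.closedBall_eq_Icc] at hu
      refine hu.2.trans (le_of_eq ?_)
      ring
    have h3 : u.toNNReal ≤ j / 2 ^ k := by
      rw [Real.toNNReal_le_iff_le_coe]
      simpa using h2
    simp only [min_eq_left h3]
  rw [h1]
  exact StronglyMeasurable.const_smul (𝕜 := ℝ) (stronglyMeasurable_integral_min hψ _
    (volume.restrict (Metric.closedBall (((j : ℝ) - 1 / 2) / 2 ^ k) (1 / 2 / 2 ^ k)))) _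

/-- The simple integrand whose value on a dyadic interval is the average of `ψ` over the
preceding one. -/
def dyadicIntegrand (hψ : IsStronglyPredictable 𝓕 ψ) {C : ℝ} (hC : ∀ s ω, ‖ψ s ω‖ ≤ C) (T : ℝ≥0)
    (k : ℕ) : SimpleIntegrand 𝓕 m where
  N := ⌈T * 2 ^ k⌉₊
  time j := j / 2 ^ k
  mono i j hij := by
    have : (i : ℝ≥0) ≤ j := by exact_mod_cast hij
    exact div_le_div_of_nonneg_right this (by positivity)
  val j := dyadicAverage ψ k j
  meas j := stronglyMeasurable_dyadicAverage hψ k j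
  bdd := ⟨C, norm_dyadicAverage_le hC k⟩

lemma norm_dyadicIntegrand_le (hψ : IsStronglyPredictable 𝓕 ψ) {C : ℝ}
    (hC : ∀ s ω, ‖ψ s ω‖ ≤ C) (T : ℝ≥0) (k : ℕ) (s : ℝ≥0) (ω : Ω) :
    ‖(dyadicIntegrand hψ hC T k).toFun s ω‖ ≤ C :=
  (dyadicIntegrand hψ hC T k).norm_toFun_le ((norm_nonneg _).trans (hC 0 ω))
    (norm_dyadicAverage_le hC k) s ω

/-- The intervals are open on the left and closed on the right, so the one containing `s` has index
the ceiling of `s * 2 ^ k` minus one; the ceiling is positive because `s > 0`. -/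
lemma dyadicIntegrand_eq (hψ : IsStronglyPredictable 𝓕 ψ) {C : ℝ}
    (hC : ∀ s ω, ‖ψ s ω‖ ≤ C) {T : ℝ≥0} (k : ℕ) {s : ℝ} (hs : s ∈ Set.Ioc (0 : ℝ) T) (ω : Ω) :
    (dyadicIntegrand hψ hC T k).toFun s.toNNReal ω = dyadicAverage ψ k (⌈s * 2 ^ k⌉₊ - 1) ω := by
  have h2 : (0 : ℝ) < 2 ^ k := by positivity
  have hpos : 0 < ⌈s * 2 ^ k⌉₊ := Nat.ceil_pos.2 (mul_pos hs.1 h2)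
  have hc := Nat.ceil_lt_add_one (mul_pos hs.1 h2).le
  have hle := Nat.le_ceil (s * 2 ^ k)
  refine (dyadicIntegrand hψ hC T k).toFun_eq_val (j := ⌈s * 2 ^ k⌉₊ - 1) ?_ ?_ ω
  · have : ⌈s * 2 ^ k⌉₊ ≤ ⌈T * 2 ^ k⌉₊ := by
      refine Nat.ceil_le.2 ?_
      have h3 : (T * 2 ^ k : ℝ≥0) ≤ (⌈T * 2 ^ k⌉₊ : ℝ≥0) := Nat.le_ceil _
      have h4 : (T * 2 ^ k : ℝ) ≤ (⌈T * 2 ^ k⌉₊ : ℝ) := by exact_mod_cast h3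
      exact (mul_le_mul_of_nonneg_right hs.2 h2.le).trans h4
    change _ < ⌈T * 2 ^ k⌉₊
    omega
  · change s.toNNReal ∈ Set.Ioc (((⌈s * 2 ^ k⌉₊ - 1 : ℕ) : ℝ≥0) / 2 ^ k)
      (((⌈s * 2 ^ k⌉₊ - 1 + 1 : ℕ) : ℝ≥0) / 2 ^ k)
    rw [Nat.sub_add_cancel hpos]
    constructor
    · rw [Real.lt_toNNReal_iff_coe_lt]
      push_cast [Nat.cast_sub (Nat.one_le_iff_ne_zero.2 hpos.ne')]
      rw [div_lt_iff₀ h2]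
      rw [NNReal.coe_sub (by exact_mod_cast hpos)]
      push_cast
      linarith
    · rw [Real.toNNReal_le_iff_le_coe]
      push_cast
      rwa [le_div_iff₀ h2]

lemma locallyIntegrable_section (hψ : IsStronglyPredictable 𝓕 ψ) {C : ℝ}
    (hC : ∀ s ω, ‖ψ s ω‖ ≤ C) (ω : Ω) :
    LocallyIntegrable (fun s : ℝ => ψ s.toNNReal ω) volume := by
  refine (locallyIntegrable_const C).mono (stronglyMeasurable_section hψ ω).aestronglyMeasurable
    (ae_of_all _ fun s => ?_)
  exact (hC _ _).trans (le_abs_self C)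

lemma ae_tendsto_dyadicIntegrand (hψ : IsStronglyPredictable 𝓕 ψ) {C : ℝ}
    (hC : ∀ s ω, ‖ψ s ω‖ ≤ C) (T : ℝ≥0) (ω : Ω) :
    ∀ᵐ s ∂(volume.restrict (Set.Ioc (0 : ℝ) T)),
      Tendsto (fun k => (dyadicIntegrand hψ hC T k).toFun s.toNNReal ω) atTop
        (𝓝 (ψ s.toNNReal ω)) := by
  -- Lebesgue differentiation with off-centre balls. The point `s` lies one interval to the right of
  -- the ball, hence within three radii of its centre: this is the constant `3`.
  have h := IsUnifLocDoublingMeasure.ae_tendsto_average volume (locallyIntegrable_section hψ hC ω) 3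
  filter_upwards [ae_restrict_of_ae h, ae_restrict_mem measurableSet_Ioc] with s hs hsT
  simp_rw [dyadicIntegrand_eq hψ hC _ hsT]
  refine hs (fun k => (((⌈s * 2 ^ k⌉₊ - 1 : ℕ) : ℝ) - 1 / 2) / 2 ^ k) (fun k => 1 / 2 / 2 ^ k) ?_
    (Eventually.of_forall fun k => ?_)
  · refine tendsto_nhdsWithin_iff.2 ⟨?_, Eventually.of_forall fun k => ?_⟩
    · have := (tendsto_pow_atTop_nhds_zero_of_lt_one (r := (1 / 2 : ℝ)) (by norm_num)
        (by norm_num)).const_mul (1 / 2)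
      simpa [div_eq_mul_inv] using this
    · exact Set.mem_Ioi.2 (by positivity)
  · have h2 : (0 : ℝ) < 2 ^ k := by positivity
    have hpos : 0 < ⌈s * 2 ^ k⌉₊ := Nat.ceil_pos.2 (mul_pos hsT.1 h2)
    have hc := Nat.ceil_lt_add_one (mul_pos hsT.1 h2).le
    have hle := Nat.le_ceil (s * 2 ^ k)
    rw [Real.closedBall_eq_Icc, Nat.cast_sub (Nat.one_le_iff_ne_zero.2 hpos.ne')]
    push_cast
    constructor
    · rw [← sub_nonneg]
      have : s - (((⌈s * 2 ^ k⌉₊ : ℝ) - 1 - 1 / 2) / 2 ^ k - 3 * (1 / 2 / 2 ^ k))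
          = (s * 2 ^ k - ⌈s * 2 ^ k⌉₊ + 3) / 2 ^ k := by field_simp; ring
      rw [this]
      exact div_nonneg (by linarith) h2.le
    · rw [← sub_nonneg]
      have : (((⌈s * 2 ^ k⌉₊ : ℝ) - 1 - 1 / 2) / 2 ^ k + 3 * (1 / 2 / 2 ^ k)) - s
          = (⌈s * 2 ^ k⌉₊ - s * 2 ^ k) / 2 ^ k := by field_simp; ring
      rw [this]
      exact div_nonneg (by linarith) h2.le

lemma measurable_dyadicIntegrand (hψ : IsStronglyPredictable 𝓕 ψ) {C : ℝ}
    (hC : ∀ s ω, ‖ψ s ω‖ ≤ C) (T : ℝ≥0) (k : ℕ) :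
    Measurable (onStrip (dyadicIntegrand hψ hC T k).toFun) :=
  ((dyadicIntegrand hψ hC T k).isElementaryIntegral T 0).measurable_process

variable {P : Measure Ω} [IsProbabilityMeasure P]

/-- Bounded convergence twice, in time for each fixed `ω` and then in `ω`. -/
lemma tendsto_eLpNorm_onStrip {F : ℕ → ℝ≥0 → Ω → EuclideanSpace ℝ (Fin m)} {C : ℝ} {T : ℝ≥0}
    (hF : ∀ k, Measurable (onStrip (F k))) (hψ : Measurable (onStrip ψ))
    (hFC : ∀ k s ω, ‖F k s ω‖ ≤ C) (hC : ∀ s ω, ‖ψ s ω‖ ≤ C)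
    (hlim : ∀ ω, ∀ᵐ s ∂(volume.restrict (Set.Ioc (0 : ℝ) T)),
      Tendsto (fun k => F k s.toNNReal ω) atTop (𝓝 (ψ s.toNNReal ω))) :
    Tendsto (fun k => eLpNorm (onStrip (F k) - onStrip ψ) 2 (prodTime P T)) atTop (𝓝 0) := by
  rw [← tendsto_strip_iff (fun k => (hF k).aestronglyMeasurable) hψ.aestronglyMeasurable]
  have hmd : ∀ k, Measurable fun p : Ω × ℝ =>
      ‖F k p.2.toNNReal p.1 - ψ p.2.toNNReal p.1‖ₑ ^ 2 :=
    fun k => ((hF k).sub hψ).enorm.pow_const 2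
  have hsec : ∀ k ω, Measurable fun s : ℝ => ‖F k s.toNNReal ω - ψ s.toNNReal ω‖ₑ ^ 2 := by
    intro k ω
    have := (hmd k).comp (measurable_prodMk_left (x := ω))
    simpa only [Function.comp_def] using this
  have hb : ∀ k s ω, ‖F k s ω - ψ s ω‖ₑ ^ 2 ≤ ENNReal.ofReal (C + C) ^ 2 := by
    intro k s ω
    refine pow_le_pow_left' ?_ 2
    rw [← ofReal_norm]
    exact ENNReal.ofReal_le_ofReal ((norm_sub_le _ _).trans (add_le_add (hFC k s ω) (hC s ω)))
  have hfin : ∫⁻ _ in Set.Ioc (0 : ℝ) T, ENNReal.ofReal (C + C) ^ 2 ≠ ∞ := by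
    rw [lintegral_const, Measure.restrict_apply_univ, Real.volume_Ioc]
    exact ENNReal.mul_ne_top (by finiteness) ENNReal.ofReal_ne_top
  have hinner : ∀ ω, Tendsto (fun k => ∫⁻ s in Set.Ioc (0 : ℝ) T,
      ‖F k s.toNNReal ω - ψ s.toNNReal ω‖ₑ ^ 2) atTop (𝓝 0) := by
    intro ω
    have := tendsto_lintegral_of_dominated_convergence
      (μ := volume.restrict (Set.Ioc (0 : ℝ) T)) (f := fun _ => 0)
      (F := fun k s => ‖F k s.toNNReal ω - ψ s.toNNReal ω‖ₑ ^ 2)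
      (fun _ => ENNReal.ofReal (C + C) ^ 2)
      (fun k => hsec k ω)
      (fun k => ae_of_all _ fun s => hb k _ ω) hfin ?_
    · simpa using this
    · filter_upwards [hlim ω] with s hs
      have h1 := (hs.sub_const (ψ s.toNNReal ω)).enorm
      rw [sub_self, enorm_zero] at h1
      exact tendsto_pow_two_zero_iff.2 h1
  have := tendsto_lintegral_of_dominated_convergence (μ := P) (f := fun _ => 0)
    (F := fun k ω => ∫⁻ s in Set.Ioc (0 : ℝ) T, ‖F k s.toNNReal ω - ψ s.toNNReal ω‖ₑ ^ 2)
    (fun _ => ∫⁻ _ in Set.Ioc (0 : ℝ) T, ENNReal.ofReal (C + C) ^ 2)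
    (fun k => (hmd k).lintegral_prod_right')
    (fun k => ae_of_all _ fun ω => lintegral_mono fun s => hb k _ ω)
    (by rwa [lintegral_const, measure_univ, mul_one])
    (ae_of_all _ hinner)
  simpa using this

lemma tendsto_dyadicIntegrand (hψ : IsStronglyPredictable 𝓕 ψ) {C : ℝ}
    (hC : ∀ s ω, ‖ψ s ω‖ ≤ C) (T : ℝ≥0) :
    Tendsto (fun k => eLpNorm (onStrip (dyadicIntegrand hψ hC T k).toFun - onStrip ψ) 2
      (prodTime P T)) atTop (𝓝 0) :=
  tendsto_eLpNorm_onStrip (measurable_dyadicIntegrand hψ hC T)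
    (stronglyMeasurable_onStrip hψ).measurable (norm_dyadicIntegrand_le hψ hC T) hC
    (ae_tendsto_dyadicIntegrand hψ hC T)

lemma tendsto_integral_norm_sq_dyadicIntegrand (hψ : IsStronglyPredictable 𝓕 ψ) {C : ℝ}
    (hC : ∀ s ω, ‖ψ s ω‖ ≤ C) (T : ℝ≥0) (ω : Ω) :
    Tendsto (fun k => ∫ s in (0 : ℝ)..T, ‖(dyadicIntegrand hψ hC T k).toFun s.toNNReal ω‖ ^ 2)
      atTop (𝓝 (∫ s in (0 : ℝ)..T, ‖ψ s.toNNReal ω‖ ^ 2)) := by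
  simp_rw [intervalIntegral.integral_of_le T.coe_nonneg]
  refine tendsto_integral_of_dominated_convergence (fun _ => C ^ 2) (fun k => ?_)
    (integrable_const _) (fun k => ae_of_all _ fun s => ?_) ?_
  · exact (((measurable_dyadicIntegrand hψ hC T k).comp
      (measurable_prodMk_left (x := ω))).norm.pow_const 2).aestronglyMeasurable
  · rw [norm_pow, norm_norm]
    exact pow_le_pow_left₀ (norm_nonneg _) (norm_dyadicIntegrand_le hψ hC T k _ ω) 2
  · filter_upwards [ae_tendsto_dyadicIntegrand hψ hC T ω] with s hs
    exact hs.norm.pow 2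

end TsallisPricing

namespace TsallisPricing

/-! ### Stochastic exponentials of bounded predictable processes -/

/-- Fatou gives `≤ 1`. For `≥ 1`, the second-moment bound prevents mass from escaping: truncation at
level `M` costs at most `B / M`, and the truncated integrals converge. -/
lemma lintegral_eq_one_of_tendsto {α : Type*} [MeasurableSpace α] {μ : Measure α}
    [IsProbabilityMeasure μ] {Z : ℕ → α → ℝ≥0∞} {Y : α → ℝ≥0∞} (hZ : ∀ k, AEMeasurable (Z k) μ)
    (hlim : ∀ᵐ x ∂μ, Tendsto (fun k => Z k x) atTop (𝓝 (Y x)))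
    (h1 : ∀ k, ∫⁻ x, Z k x ∂μ = 1) {B : ℝ≥0∞} (hB : B ≠ ∞) (h2 : ∀ k, ∫⁻ x, Z k x ^ 2 ∂μ ≤ B) :
    ∫⁻ x, Y x ∂μ = 1 := by
  apply le_antisymm
  · calc ∫⁻ x, Y x ∂μ = ∫⁻ x, liminf (fun k => Z k x) atTop ∂μ := by
          refine lintegral_congr_ae ?_
          filter_upwards [hlim] with x hx using hx.liminf_eq.symm
      _ ≤ liminf (fun k => ∫⁻ x, Z k x ∂μ) atTop := lintegral_liminf_le' hZ
      _ = 1 := by simp [h1]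
  · have hpt : ∀ (M : ℕ), 0 < M → ∀ z : ℝ≥0∞, z ≤ min z M + z ^ 2 / M := by
      intro M hM z
      have hM0 : (M : ℝ≥0∞) ≠ 0 := by exact_mod_cast hM.ne'
      rcases le_total z M with h | h
      · rw [min_eq_left h]
        exact le_self_add
      · refine le_trans ?_ le_add_self
        rw [sq, mul_div_assoc]
        calc z = z * 1 := (mul_one z).symm
          _ ≤ z * (z / M) := by
            gcongr
            rwa [ENNReal.le_div_iff_mul_le (Or.inl hM0) (Or.inl (ENNReal.natCast_ne_top M)), one_mul]
    have hM : ∀ M : ℕ, 0 < M → 1 ≤ ∫⁻ x, Y x ∂μ + B / M := by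
      intro M hM
      have hk : ∀ k, 1 ≤ ∫⁻ x, min (Z k x) M ∂μ + B / M := by
        intro k
        rw [← h1 k]
        calc ∫⁻ x, Z k x ∂μ ≤ ∫⁻ x, (min (Z k x) M + Z k x ^ 2 / M) ∂μ :=
              lintegral_mono fun x => hpt M hM _
          _ = ∫⁻ x, min (Z k x) M ∂μ + (∫⁻ x, Z k x ^ 2 ∂μ) / M := by
              simp_rw [div_eq_mul_inv]
              rw [lintegral_add_left' ((hZ k).min aemeasurable_const),
                lintegral_mul_const'' _ ((hZ k).pow_const 2)]
          _ ≤ _ := by gcongr; exact h2 k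
      have hlimM : Tendsto (fun k => ∫⁻ x, min (Z k x) M ∂μ) atTop (𝓝 (∫⁻ x, min (Y x) M ∂μ)) := by
        refine tendsto_lintegral_of_dominated_convergence' (fun _ => (M : ℝ≥0∞))
          (fun k => (hZ k).min aemeasurable_const)
          (fun k => ae_of_all _ fun x => min_le_right _ _) (by simp) ?_
        filter_upwards [hlim] with x hx using hx.min tendsto_const_nhds
      have hle := ge_of_tendsto' (hlimM.add_const (B / M)) hk
      refine hle.trans ?_
      gcongr
      exact min_le_left _ _
    have hBM : Tendsto (fun M : ℕ => ∫⁻ x, Y x ∂μ + B / M) atTop (𝓝 (∫⁻ x, Y x ∂μ + 0)) := by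
      refine Tendsto.const_add _ ?_
      have := ENNReal.Tendsto.const_div (a := B) ENNReal.tendsto_nat_nhds_top (Or.inr hB)
      simpa using this
    rw [add_zero] at hBM
    refine ge_of_tendsto hBM ?_
    filter_upwards [eventually_gt_atTop 0] with M h using hM M h

variable {Ω : Type*} {mΩ : MeasurableSpace Ω} {m : ℕ} {P : Measure Ω} [IsProbabilityMeasure P]
  {𝓕 : Filtration ℝ≥0 mΩ} {T : ℝ≥0} {W ψ : ℝ≥0 → Ω → EuclideanSpace ℝ (Fin m)} {I : Ω → ℝ}

/-- Induction over the steps by the one-step exponential identity, with adaptedness of the partial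
exponent carried along. The parameter `c` is used at `-1` for the mean and at `-2` for the second
moment. -/
lemma SimpleIntegrand.lintegral_exp (hX : IsStoppedBrownian P 𝓕 T (fun s => W (min s T)))
    (φ : SimpleIntegrand 𝓕 m) (c : ℝ) :
    ∫⁻ ω, ENNReal.ofReal (Real.exp (c * φ.integral T W ω
      - c ^ 2 / 2 * ∫ s in (0 : ℝ)..T, ‖φ.toFun s.toNNReal ω‖ ^ 2)) ∂P = 1 := by
  simp_rw [φ.integral_norm_sq_toFun, SimpleIntegrand.integral, Finset.mul_sum,
    ← Finset.sum_sub_distrib]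
  have hmono := φ.mono
  have key : ∀ n : ℕ, Measurable[𝓕 (φ.time n)] (fun ω => ∑ j ∈ Finset.range n,
      (c * inner ℝ (φ.val j ω) (W (min (φ.time (j + 1)) T) ω - W (min (φ.time j) T) ω)
        - c ^ 2 / 2 * ((min (φ.time (j + 1)) T - min (φ.time j) T : ℝ≥0) * ‖φ.val j ω‖ ^ 2))) ∧
      ∫⁻ ω, ENNReal.ofReal (Real.exp (∑ j ∈ Finset.range n,
      (c * inner ℝ (φ.val j ω) (W (min (φ.time (j + 1)) T) ω - W (min (φ.time j) T) ω)
        - c ^ 2 / 2 * ((min (φ.time (j + 1)) T - min (φ.time j) T : ℝ≥0) * ‖φ.val j ω‖ ^ 2)))) ∂P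
        = 1 := by
    intro n
    induction n with
    | zero => simp
    | succ n ih =>
      obtain ⟨ih1, ih2⟩ := ih
      have hs := hmono n.le_succ
      simp_rw [Finset.sum_range_succ]
      constructor
      · have e1 := hX.measurable_inner_increment hs hs (φ.meas n).measurable
        have e2 := (φ.meas n).measurable.mono (𝓕.mono hs) le_rfl
        exact (ih1.mono (𝓕.mono hs) le_rfl).add
          ((e1.const_mul c).sub ((((measurable_norm.comp e2).pow_const 2).const_mul _).const_mul _))
      · have hv : Measurable[𝓕 (φ.time n)] (fun ω => c • φ.val n ω) :=
          (φ.meas n).measurable.const_smul c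
        have h := hX.lintegral_mul_exp_increment hs (ih1.exp.ennreal_ofReal) hv
        rw [ih2] at h
        rw [← h]
        refine lintegral_congr fun ω => ?_
        rw [Real.exp_add, ENNReal.ofReal_mul (Real.exp_nonneg _), real_inner_smul_left, norm_smul,
          mul_pow, Real.norm_eq_abs, sq_abs]
        congr 4
        ring
  exact (key φ.N).2

/-- The stochastic exponential of a bounded predictable process has expectation one. -/
theorem lintegral_stochasticExponential (hX : IsStoppedBrownian P 𝓕 T (fun s => W (min s T)))
    (hψ : IsStronglyPredictable 𝓕 ψ) {C : ℝ} (hC : ∀ s ω, ‖ψ s ω‖ ≤ C)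
    (hI : IsItoLimit P 𝓕 T (fun s => W (min s T)) ψ I) :
    ∫⁻ ω, ENNReal.ofReal (Real.exp (-I ω
      - 1 / 2 * ∫ s in (0 : ℝ)..T, ‖ψ s.toNNReal ω‖ ^ 2)) ∂P = 1 := by
  have hel := fun k => (dyadicIntegrand hψ hC T k).isElementaryIntegral T W
  have hlim := hI.tendsto_of_tendsto hX hel (tendsto_dyadicIntegrand hψ hC T)
  have hmeas := fun k => ((hel k).memLp hX).1
  -- Mean-square convergence gives almost sure convergence only along a subsequence, which is enough
  -- here.
  obtain ⟨ns, hns, hae⟩ := (tendstoInMeasure_of_tendsto_eLpNorm two_ne_zero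
    hmeas hI.measurable_limit hlim).exists_seq_tendsto_ae
  have hQm : ∀ k, Measurable fun ω =>
      ∫ s in (0 : ℝ)..T, ‖(dyadicIntegrand hψ hC T k).toFun s.toNNReal ω‖ ^ 2 := by
    intro k
    simp_rw [SimpleIntegrand.integral_norm_sq_toFun]
    refine Finset.measurable_sum _ fun j _ => ?_
    exact ((((dyadicIntegrand hψ hC T k).meas j).measurable.mono (𝓕.le _) le_rfl).norm.pow_const
      2).const_mul _
  have hQle : ∀ k ω, ∫ s in (0 : ℝ)..T, ‖(dyadicIntegrand hψ hC T k).toFun s.toNNReal ω‖ ^ 2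
      ≤ C ^ 2 * T := by
    intro k ω
    have := intervalIntegral.norm_integral_le_of_norm_le_const (a := (0 : ℝ)) (b := T) (C := C ^ 2)
      (f := fun s : ℝ => ‖(dyadicIntegrand hψ hC T k).toFun s.toNNReal ω‖ ^ 2) (fun s _ => by
        rw [norm_pow, norm_norm]
        exact pow_le_pow_left₀ (norm_nonneg _) (norm_dyadicIntegrand_le hψ hC T k _ ω) 2)
    rw [sub_zero, abs_of_nonneg T.coe_nonneg] at this
    exact (le_abs_self _).trans this
  refine lintegral_eq_one_of_tendsto (Z := fun i ω => ENNReal.ofReal (Real.exp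
      (-(dyadicIntegrand hψ hC T (ns i)).integral T W ω - 1 / 2 *
        ∫ s in (0 : ℝ)..T, ‖(dyadicIntegrand hψ hC T (ns i)).toFun s.toNNReal ω‖ ^ 2)))
    (fun i => ?_) ?_ (fun i => ?_) (B := ENNReal.ofReal (Real.exp (C ^ 2 * T)))
    ENNReal.ofReal_ne_top (fun i => ?_)
  · exact (Real.measurable_exp.comp_aemeasurable ((hmeas (ns i)).aemeasurable.neg.sub
      ((hQm (ns i)).const_mul _).aemeasurable)).ennreal_ofReal
  · filter_upwards [hae] with ω hω
    refine ENNReal.tendsto_ofReal (Real.continuous_exp.tendsto _ |>.comp (hω.neg.sub ?_))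
    exact ((tendsto_integral_norm_sq_dyadicIntegrand hψ hC T ω).comp hns.tendsto_atTop).const_mul _
  · have := (dyadicIntegrand hψ hC T (ns i)).lintegral_exp hX (-1)
    norm_num at this ⊢
    exact this
  -- With `V = ∫ ‖φ‖²`, the square of the exponential is `exp(-2I - V) = exp(V) * exp(-2I - 2V)`;
  -- the last factor has mean one and `V ≤ C² T`.
  · have := (dyadicIntegrand hψ hC T (ns i)).lintegral_exp hX (-2)
    calc _ ≤ ∫⁻ ω, ENNReal.ofReal (Real.exp (C ^ 2 * T)) * ENNReal.ofReal (Real.exp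
          (-2 * (dyadicIntegrand hψ hC T (ns i)).integral T W ω - (-2) ^ 2 / 2 *
          ∫ s in (0 : ℝ)..T, ‖(dyadicIntegrand hψ hC T (ns i)).toFun s.toNNReal ω‖ ^ 2)) ∂P := by
          refine lintegral_mono fun ω => ?_
          rw [← ENNReal.ofReal_pow (Real.exp_nonneg _), ← ENNReal.ofReal_mul (Real.exp_nonneg _),
            ← Real.exp_add, ← Real.exp_nat_mul]
          refine ENNReal.ofReal_le_ofReal (Real.exp_le_exp.2 ?_)
          have := hQle (ns i) ω
          push_cast
          linarith
      _ = _ := by rw [lintegral_const_mul' _ _ ENNReal.ofReal_ne_top, this, mul_one]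

end TsallisPricing

namespace TsallisPricing

/-! ### The Brownian motion of the market relative to the augmented filtration -/

section Augmentation

variable {Ω : Type*} {mΩ : MeasurableSpace Ω} {P : Measure Ω}

/-- The sets almost surely equal to an `F`-measurable one form a σ-algebra containing both `F` and
the null sets. -/
lemma exists_ae_eq_of_measurableSet_sup {F : MeasurableSpace Ω} {A : Set Ω}
    (hA : MeasurableSet[F ⊔ MeasurableSpace.generateFrom {A | P A = 0}] A) :
    ∃ A', MeasurableSet[F] A' ∧ A =ᵐ[P] A' := by
  have hle : F ⊔ MeasurableSpace.generateFrom {A | P A = 0}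
      ≤ eventuallyMeasurableSpace F (ae P) := by
    refine sup_le le_eventuallyMeasurableSpace (MeasurableSpace.generateFrom_le fun N hN => ?_)
    exact ⟨∅, MeasurableSet.empty, ae_eq_empty.2 hN⟩
  exact hle A hA

lemma indep_sup_nullSets {F G : MeasurableSpace Ω} (h : Indep F G P) :
    Indep (F ⊔ MeasurableSpace.generateFrom {A | P A = 0}) G P := by
  rw [Indep_iff] at h ⊢
  intro A B hA hB
  obtain ⟨A', hA', hAA'⟩ := exists_ae_eq_of_measurableSet_sup hA
  rw [measure_congr hAA', ← h A' B hA' hB]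
  exact measure_congr (hAA'.inter (ae_eq_refl B))

lemma map_pi_castAdd (m n : ℕ) (ν : Measure ℝ) [IsProbabilityMeasure ν] :
    (Measure.pi fun _ : Fin (m + n) => ν).map (fun x (i : Fin m) => x (Fin.castAdd n i))
      = Measure.pi fun _ : Fin m => ν := by
  have h1 : iIndepFun (fun (i : Fin (m + n)) (x : Fin (m + n) → ℝ) => x i)
      (Measure.pi fun _ : Fin (m + n) => ν) :=
    iIndepFun_pi (X := fun _ (x : ℝ) => x) fun _ => aemeasurable_id
  have h2 := h1.precomp (Fin.castAdd_injective m n)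
  have h3 := (iIndepFun_iff_map_fun_eq_pi_map 
    (fun i => (measurable_pi_apply (Fin.castAdd n i)).aemeasurable)).1 h2
  rw [h3]
  congr 1
  funext i
  exact (measurePreserving_eval (fun _ : Fin (m + n) => ν) (Fin.castAdd n i)).map_eq

end Augmentation

namespace BrownianMarket

variable {Ω : Type*} [mΩ : MeasurableSpace Ω] {m n : ℕ} (M : BrownianMarket Ω m n)

lemma raw_le_𝓕 (t : ℝ≥0) : rawFiltration M.T M.B M.isBrownianMotion.measurable t ≤ M.𝓕 t :=
  le_sup_left

/-- `W` stays Brownian in the larger filtration of `(W, W^⊥)`: its increments are functions of those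
of `B`, which are independent of the past of `B`, and adding null sets preserves independence. -/
lemma isStoppedBrownian :
    IsStoppedBrownian M.P M.𝓕 M.T (fun s => M.W (min s M.T)) where
  adapted t := by
    have h1 : Measurable[M.𝓕 t] (M.B (min t M.T)) := by
      refine Measurable.mono (measurable_iff_comap_le.2 le_rfl) (le_trans ?_ (M.raw_le_𝓕 t)) le_rfl
      exact le_iSup₂_of_le (f := fun s (_ : s ≤ min t M.T) =>
        MeasurableSpace.comap (M.B s) inferInstance) (min t M.T) le_rfl le_rfl
    exact measurable_firstComponents h1
  law s t hst := by
    have hst' : min s M.T ≤ min t M.T := min_le_min_right _ hst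
    have h := M.isBrownianMotion.law_increment _ _ hst' (min_le_right _ _)
    have h1 : (fun ω => M.W (min t M.T) ω - M.W (min s M.T) ω)
        = (WithLp.toLp 2 ∘ fun (x : Fin (m + n) → ℝ) (i : Fin m) => x (Fin.castAdd n i)) ∘
          fun ω (i : Fin (m + n)) => M.B (min t M.T) ω i - M.B (min s M.T) ω i := by
      funext ω
      ext i
      simp [W, firstComponents]
    have h2 : Measurable fun (x : Fin (m + n) → ℝ) (i : Fin m) => x (Fin.castAdd n i) := by
      fun_prop
    have h3 : Measurable (WithLp.toLp 2 : (Fin m → ℝ) → EuclideanSpace ℝ (Fin m)) := by fun_prop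
    rw [h1, ← AEMeasurable.map_map_of_aemeasurable (h3.comp h2).aemeasurable h.aemeasurable,
      h.map_eq, ← Measure.map_map h3 h2, map_pi_castAdd, isotropicGaussian]
  indep s t hst := by
    have hst' : min s M.T ≤ min t M.T := min_le_min_right _ hst
    have h := M.isBrownianMotion.indep_increment _ _ hst' (min_le_right _ _)
    have hle : MeasurableSpace.comap (fun ω => M.W (min t M.T) ω - M.W (min s M.T) ω) inferInstance
        ≤ MeasurableSpace.comap (fun ω => M.B (min t M.T) ω - M.B (min s M.T) ω)
          inferInstance := by
      have h1 : (fun ω => M.W (min t M.T) ω - M.W (min s M.T) ω)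
          = (fun x : EuclideanSpace ℝ (Fin (m + n)) =>
            (WithLp.toLp 2 fun i => x (Fin.castAdd n i) : EuclideanSpace ℝ (Fin m))) ∘
            fun ω => M.B (min t M.T) ω - M.B (min s M.T) ω := by
        funext ω
        ext i
        simp [W, firstComponents]
      rw [h1, ← MeasurableSpace.comap_comp]
      refine MeasurableSpace.comap_mono (Measurable.comap_le ?_)
      fun_prop
    exact indep_sup_nullSets (indep_of_indep_of_le_right h hle)

/-! ### The drift and the density of the minimal martingale measure -/

/-- The drift, set to zero after the horizon. -/
def drift (t : ℝ≥0) (ω : Ω) : EuclideanSpace ℝ (Fin m) :=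
  (Set.Iic M.T).indicator (fun s => M.lam s ω) t

lemma rawW_le_𝓕 (t : ℝ≥0) : rawFiltration M.T (firstComponents M.B)
    (fun t ht => measurable_firstComponents (M.isBrownianMotion.measurable t ht)) t ≤ M.𝓕 t := by
  refine iSup₂_le fun s hs => ?_
  have h := M.isStoppedBrownian.adapted s
  rw [min_eq_left (hs.trans (min_le_right _ _))] at h
  exact h.comap_le.trans (M.𝓕.mono (hs.trans (min_le_left _ _)))

lemma isStronglyPredictable_lam : IsStronglyPredictable M.𝓕 M.lam :=
  StronglyMeasurable.mono M.lam_predictable (predictable_mono M.rawW_le_𝓕)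

lemma isStronglyPredictable_drift : IsStronglyPredictable M.𝓕 M.drift := by
  have h1 : MeasurableSet[M.𝓕.predictable] ((Set.Ioi M.T ×ˢ (Set.univ : Set Ω))ᶜ) :=
    (measurableSet_predictable_Ioi_prod MeasurableSet.univ).compl
  have h2 : Function.uncurry M.drift = ((Set.Ioi M.T ×ˢ (Set.univ : Set Ω))ᶜ).indicator
      (Function.uncurry M.lam) := by
    funext p
    by_cases h : p.1 ≤ M.T
    · rw [Set.indicator_of_mem (by simpa using h)]
      exact Set.indicator_of_mem (s := Set.Iic M.T) h (fun s => M.lam s p.2)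
    · rw [Set.indicator_of_notMem (by simpa using h)]
      exact Set.indicator_of_notMem (s := Set.Iic M.T) h (fun s => M.lam s p.2)
  unfold IsStronglyPredictable
  rw [h2]
  exact StronglyMeasurable.indicator M.isStronglyPredictable_lam h1

lemma drift_eq {t : ℝ≥0} (ht : t ≤ M.T) (ω : Ω) : M.drift t ω = M.lam t ω :=
  Set.indicator_of_mem (s := Set.Iic M.T) ht _

/-- The purpose of the cut-off: `lam` is bounded only up to `T`, whereas the approximation lemmas
need a bound at all times. -/
lemma exists_norm_drift_le : ∃ C : ℝ, ∀ s ω, ‖M.drift s ω‖ ≤ C := by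
  obtain ⟨C, hC⟩ := M.lam_bounded
  refine ⟨max C 0, fun s ω => ?_⟩
  by_cases h : s ≤ M.T
  · rw [M.drift_eq h]
    exact (hC s h ω).trans (le_max_left _ _)
  · have : M.drift s ω = 0 := Set.indicator_of_notMem (s := Set.Iic M.T) h _
    rw [this, norm_zero]
    exact le_max_right _ _

lemma onStrip_drift_ae_eq : onStrip M.drift =ᵐ[prodTime M.P M.T] onStrip M.lam := by
  have h : ∀ᵐ p ∂(prodTime M.P M.T), p.2 ∈ Set.Ioc (0 : ℝ) M.T :=
    Measure.quasiMeasurePreserving_snd.ae (ae_restrict_mem measurableSet_Ioc)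
  filter_upwards [h] with p hp
  exact M.drift_eq (Real.toNNReal_le_iff_le_coe.2 hp.2) p.1

/-- Ensures that `itoIntegral` is a genuine integral and not its default value `0`. The dyadic
integrands of `drift` serve for `lam`, since the two agree on the strip. -/
lemma isItoIntegral_itoIntegral :
    IsItoIntegral M.P M.𝓕 M.T M.W M.lam (itoIntegral M.P M.𝓕 M.T M.W M.lam) := by
  obtain ⟨C, hC⟩ := M.exists_norm_drift_le
  have hex : ∃ I, IsItoIntegral M.P M.𝓕 M.T M.W M.lam I := by
    refine exists_isItoIntegral M.isStoppedBrownian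
      (stronglyMeasurable_onStrip M.isStronglyPredictable_lam).aestronglyMeasurable
      (dyadicIntegrand M.isStronglyPredictable_drift hC M.T) ?_
    refine (tendsto_dyadicIntegrand (P := M.P) M.isStronglyPredictable_drift hC M.T).congr
      fun k => eLpNorm_congr_ae ?_
    filter_upwards [M.onStrip_drift_ae_eq] with p hp
    simp [hp]
  rw [itoIntegral, dif_pos hex]
  exact Classical.choose_spec hex

lemma isItoLimit_drift :
    IsItoLimit M.P M.𝓕 M.T (fun s => M.W (min s M.T)) M.drift
      (itoIntegral M.P M.𝓕 M.T M.W M.lam) := by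
  obtain ⟨-, h2, F, K, hFK, hF, hK⟩ := M.isItoIntegral_itoIntegral.isItoLimit
    (stronglyMeasurable_onStrip M.isStronglyPredictable_lam).aestronglyMeasurable
  refine ⟨(stronglyMeasurable_onStrip M.isStronglyPredictable_drift).aestronglyMeasurable, h2,
    F, K, hFK, hF.congr fun k => eLpNorm_congr_ae ?_, hK⟩
  filter_upwards [M.onStrip_drift_ae_eq] with p hp
  simp [hp]

lemma intervalIntegrable_drift (ω : Ω) (a b : ℝ) :
    IntervalIntegrable (fun s : ℝ => M.drift s.toNNReal ω) volume a b := by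
  obtain ⟨C, hC⟩ := M.exists_norm_drift_le
  exact ((locallyIntegrable_section M.isStronglyPredictable_drift hC ω).integrableOn_isCompact
    isCompact_uIcc).intervalIntegrable

lemma integral_lam_eq {t : ℝ≥0} (ht : t ≤ M.T) (ω : Ω) :
    ∫ s in (0 : ℝ)..t, M.lam s.toNNReal ω = ∫ s in (0 : ℝ)..t, M.drift s.toNNReal ω := by
  refine intervalIntegral.integral_congr fun s hs => ?_
  rw [Set.uIcc_of_le t.coe_nonneg] at hs
  exact (M.drift_eq ((Real.toNNReal_le_iff_le_coe.2 hs.2).trans ht) ω).symm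

lemma integral_norm_sq_lam_eq (ω : Ω) :
    ∫ s in (0 : ℝ)..M.T, ‖M.lam s.toNNReal ω‖ ^ 2
      = ∫ s in (0 : ℝ)..M.T, ‖M.drift s.toNNReal ω‖ ^ 2 := by
  refine intervalIntegral.integral_congr fun s hs => ?_
  rw [Set.uIcc_of_le M.T.coe_nonneg] at hs
  simp only [M.drift_eq (Real.toNNReal_le_iff_le_coe.2 hs.2) ω]

lemma S_sub {s t : ℝ≥0} (hst : s ≤ t) (ht : t ≤ M.T) (ω : Ω) :
    M.S t ω - M.S s ω = (∫ u in (s : ℝ)..t, M.drift u.toNNReal ω) + (M.W t ω - M.W s ω) := by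
  have h := intervalIntegral.integral_interval_sub_left (M.intervalIntegrable_drift ω 0 t)
    (M.intervalIntegrable_drift ω 0 s)
  rw [S, S, M.integral_lam_eq ht, M.integral_lam_eq (hst.trans ht), ← h]
  abel

/-- The drift perturbed by `θ` on `A × (s, t]`. -/
def tiltedDrift (s t : ℝ≥0) (A : Set Ω) (θ : EuclideanSpace ℝ (Fin m)) (u : ℝ≥0) (ω : Ω) :
    EuclideanSpace ℝ (Fin m) :=
  M.drift u ω - (Set.Ioc s t).indicator (fun _ => A.indicator (fun _ => θ) ω) u

lemma isStronglyPredictable_tiltedDrift {s t : ℝ≥0} {A : Set Ω} (hA : MeasurableSet[M.𝓕 s] A)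
    (θ : EuclideanSpace ℝ (Fin m)) : IsStronglyPredictable M.𝓕 (M.tiltedDrift s t A θ) := by
  have h1 := measurableSet_predictable_Ioc_prod s t hA
  have h2 : Function.uncurry (M.tiltedDrift s t A θ) = fun p => Function.uncurry M.drift p
      - (Set.Ioc s t ×ˢ A).indicator (fun _ => θ) p := by
    funext p
    by_cases hp : p.1 ∈ Set.Ioc s t <;> by_cases hA' : p.2 ∈ A <;>
      simp [tiltedDrift, Function.uncurry, Set.indicator, hp, hA']
  unfold IsStronglyPredictable
  rw [h2]
  exact StronglyMeasurable.sub M.isStronglyPredictable_drift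
    (StronglyMeasurable.indicator stronglyMeasurable_const h1)

lemma exists_norm_tiltedDrift_le (s t : ℝ≥0) (A : Set Ω) (θ : EuclideanSpace ℝ (Fin m)) :
    ∃ C : ℝ, ∀ u ω, ‖M.tiltedDrift s t A θ u ω‖ ≤ C := by
  obtain ⟨C, hC⟩ := M.exists_norm_drift_le
  refine ⟨C + ‖θ‖, fun u ω => (norm_sub_le _ _).trans (add_le_add (hC u ω) ?_)⟩
  exact (norm_indicator_le_norm_self (fun _ => A.indicator (fun _ => θ) ω) u).trans
    (norm_indicator_le_norm_self (fun _ => θ) ω)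

lemma integral_norm_sq_tiltedDrift_of_notMem (s t : ℝ≥0) {A : Set Ω}
    (θ : EuclideanSpace ℝ (Fin m)) {ω : Ω} (hω : ω ∉ A) :
    ∫ u in (0 : ℝ)..M.T, ‖M.tiltedDrift s t A θ u.toNNReal ω‖ ^ 2
      = ∫ u in (0 : ℝ)..M.T, ‖M.drift u.toNNReal ω‖ ^ 2 := by
  simp [tiltedDrift, Set.indicator_of_notMem hω]

/-- The square is expanded on `(s, t]`; its cross term is the drift part of the price increment. -/
lemma integral_norm_sq_tiltedDrift_of_mem {s t : ℝ≥0} (hst : s ≤ t) (ht : t ≤ M.T) {A : Set Ω}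
    (θ : EuclideanSpace ℝ (Fin m)) {ω : Ω} (hω : ω ∈ A) :
    ∫ u in (0 : ℝ)..M.T, ‖M.tiltedDrift s t A θ u.toNNReal ω‖ ^ 2
      = (∫ u in (0 : ℝ)..M.T, ‖M.drift u.toNNReal ω‖ ^ 2)
        - 2 * inner ℝ θ (∫ u in (s : ℝ)..t, M.drift u.toNNReal ω) + (t - s) * ‖θ‖ ^ 2 := by
  obtain ⟨C, hC⟩ := M.exists_norm_drift_le
  have hm := stronglyMeasurable_section M.isStronglyPredictable_drift ω
  have hsq : IntegrableOn (fun u : ℝ => ‖M.drift u.toNNReal ω‖ ^ 2) (Set.Ioc 0 M.T) := by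
    refine Integrable.of_bound (C := C ^ 2) (hm.norm.pow 2).aestronglyMeasurable
      (ae_of_all _ fun u => ?_)
    rw [norm_pow, norm_norm]
    exact pow_le_pow_left₀ (norm_nonneg _) (hC _ ω) 2
  have hinn : IntegrableOn (fun u : ℝ => (inner ℝ θ (M.drift u.toNNReal ω) : ℝ)) (Set.Ioc s t) :=
    (M.intervalIntegrable_drift ω s t).1.const_inner θ
  have hg : IntegrableOn (fun u : ℝ => 2 * inner ℝ θ (M.drift u.toNNReal ω) - ‖θ‖ ^ 2)
      (Set.Ioc (s : ℝ) t) := (hinn.const_mul 2).sub (integrable_const _)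
  have hsub : Set.Ioc (s : ℝ) t ⊆ Set.Ioc (0 : ℝ) M.T :=
    Set.Ioc_subset_Ioc s.coe_nonneg (by exact_mod_cast ht)
  have hst' : (s : ℝ) ≤ t := by exact_mod_cast hst
  have hpt : ∀ u ∈ Set.Ioc (0 : ℝ) M.T, ‖M.tiltedDrift s t A θ u.toNNReal ω‖ ^ 2
      = ‖M.drift u.toNNReal ω‖ ^ 2 - (Set.Ioc (s : ℝ) t).indicator
        (fun u : ℝ => 2 * inner ℝ θ (M.drift u.toNNReal ω) - ‖θ‖ ^ 2) u := by
    intro u hu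
    by_cases h : u ∈ Set.Ioc (s : ℝ) t
    · have h' : u.toNNReal ∈ Set.Ioc s t :=
        ⟨Real.lt_toNNReal_iff_coe_lt.2 h.1, Real.toNNReal_le_iff_le_coe.2 h.2⟩
      rw [tiltedDrift, Set.indicator_of_mem h', Set.indicator_of_mem hω, Set.indicator_of_mem h,
        norm_sub_sq_real, real_inner_comm]
      ring
    · have h' : u.toNNReal ∉ Set.Ioc s t := fun h' =>
        h ⟨Real.lt_toNNReal_iff_coe_lt.1 h'.1, Real.toNNReal_le_iff_le_coe.1 h'.2⟩
      rw [tiltedDrift, Set.indicator_of_notMem h', Set.indicator_of_notMem h, sub_zero, sub_zero]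
  rw [intervalIntegral.integral_of_le M.T.coe_nonneg, setIntegral_congr_fun measurableSet_Ioc hpt,
    integral_sub hsq ((integrable_indicator_iff measurableSet_Ioc).2
      (hg.mono_measure Measure.restrict_le_self)),
    setIntegral_indicator measurableSet_Ioc, Set.inter_eq_right.2 hsub,
    integral_sub (hinn.const_mul 2) (integrable_const _), integral_const_mul,
    integral_inner (M.intervalIntegrable_drift ω s t).1, setIntegral_const, measureReal_def,
    Real.volume_Ioc, ENNReal.toReal_ofReal (sub_nonneg.2 hst'),
    ← intervalIntegral.integral_of_le M.T.coe_nonneg, ← intervalIntegral.integral_of_le hst',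
    smul_eq_mul]
  ring

/-- The density of `Q^min` with respect to `P`. -/
def minDensity (ω : Ω) : ℝ≥0∞ :=
  ENNReal.ofReal (Real.exp (-itoIntegral M.P M.𝓕 M.T M.W M.lam ω
      - 1 / 2 * ∫ s in (0 : ℝ)..M.T, ‖M.lam s.toNNReal ω‖ ^ 2))

lemma aemeasurable_minDensity : AEMeasurable M.minDensity M.P := by
  have h1 := M.isItoIntegral_itoIntegral.1.1.aemeasurable
  have h2 : Measurable fun ω => ∫ s in (0 : ℝ)..M.T, ‖M.lam s.toNNReal ω‖ ^ 2 := by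
    simp_rw [intervalIntegral.integral_of_le M.T.coe_nonneg]
    have h3 : StronglyMeasurable fun p : Ω × ℝ => ‖M.lam p.2.toNNReal p.1‖ ^ 2 :=
      (stronglyMeasurable_onStrip M.isStronglyPredictable_lam).norm.pow 2
    exact h3.integral_prod_right'.measurable
  exact (Real.measurable_exp.comp_aemeasurable
    (h1.neg.sub (h2.const_mul _).aemeasurable)).ennreal_ofReal

lemma Qmin_eq : M.Qmin = M.P.withDensity M.minDensity := rfl

lemma minDensity_ne_zero (ω : Ω) : M.minDensity ω ≠ 0 :=
  (ENNReal.ofReal_pos.2 (Real.exp_pos _)).ne'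

lemma Qmin_absolutelyContinuous : M.Qmin ≪ M.P := withDensity_absolutelyContinuous _ _

lemma absolutelyContinuous_Qmin : M.P ≪ M.Qmin :=
  withDensity_absolutelyContinuous' M.aemeasurable_minDensity
    (ae_of_all _ M.minDensity_ne_zero)

/-- Girsanov's theorem in exponential form. -/
lemma lintegral_exp_increment_Qmin_aux {s t : ℝ≥0} (hst : s ≤ t) (ht : t ≤ M.T) {A : Set Ω}
    (hA : MeasurableSet[M.𝓕 s] A) (θ : EuclideanSpace ℝ (Fin m)) :
    ∫⁻ ω, M.minDensity ω * ENNReal.ofReal (Real.exp (A.indicator (fun ω =>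
      inner ℝ θ (M.S t ω - M.S s ω) - (t - s) / 2 * ‖θ‖ ^ 2) ω)) ∂M.P = 1 := by
  obtain ⟨C, hC⟩ := M.exists_norm_tiltedDrift_le s t A θ
  have hAθ : Measurable[M.𝓕 s] (A.indicator fun _ => θ) :=
    Measurable.indicator measurable_const hA
  have hb : ∃ K : ℝ, ∀ ω, ‖A.indicator (fun _ => θ) ω‖ ≤ K :=
    ⟨‖θ‖, fun ω => norm_indicator_le_norm_self (fun _ => θ) ω⟩
  -- The integrand is the stochastic exponential of the tilted drift. Its Itô integral loses `⟨θ,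
  -- W_t - W_s⟩` on `A`, and the cross term of the squared norm supplies `⟨θ, ∫ drift⟩`; together
  -- they form `⟨θ, S_t - S_s⟩`.
  have hlim := M.isItoLimit_drift.sub_elementary (.step hst hAθ hb) M.isStoppedBrownian
  have h := lintegral_stochasticExponential M.isStoppedBrownian
    (M.isStronglyPredictable_tiltedDrift (t := t) hA θ) hC hlim
  rw [← h]
  refine lintegral_congr fun ω => ?_
  rw [minDensity, ← ENNReal.ofReal_mul (Real.exp_nonneg _), ← Real.exp_add,
    M.integral_norm_sq_lam_eq]
  congr 2
  by_cases hω : ω ∈ A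
  · rw [M.integral_norm_sq_tiltedDrift_of_mem hst ht θ hω, Set.indicator_of_mem hω,
      Set.indicator_of_mem hω, M.S_sub hst ht, inner_add_right, min_eq_left ht,
      min_eq_left (hst.trans ht)]
    ring
  · rw [M.integral_norm_sq_tiltedDrift_of_notMem s t θ hω, Set.indicator_of_notMem hω,
      Set.indicator_of_notMem hω, inner_zero_left]
    ring

instance : IsProbabilityMeasure M.Qmin := by
  refine ⟨?_⟩
  -- With `A = ∅` there is no tilt, and the identity says that the density has total mass one.
  have h := M.lintegral_exp_increment_Qmin_aux (s := 0) (t := 0) le_rfl zero_le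
    (A := ∅) (@MeasurableSet.empty _ (M.𝓕 0)) 0
  rw [Qmin_eq, withDensity_apply _ MeasurableSet.univ, setLIntegral_univ, ← h]
  simp

end BrownianMarket

end TsallisPricing

namespace TsallisPricing

namespace BrownianMarket

variable {Ω : Type*} [mΩ : MeasurableSpace Ω] {m n : ℕ} (M : BrownianMarket Ω m n)

/-! ### Prices are martingales under the minimal martingale measure -/

lemma stronglyMeasurable_S {t : ℝ≥0} (ht : t ≤ M.T) : StronglyMeasurable[M.𝓕 t] (M.S t) := by
  have h1 := M.isStoppedBrownian.adapted t
  rw [min_eq_left ht] at h1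
  have h2 := stronglyMeasurable_integral_min M.isStronglyPredictable_drift t
    (volume.restrict (Set.Ioc (0 : ℝ) t))
  have h3 : (fun ω => ∫ u in Set.Ioc (0 : ℝ) t, M.drift (min u.toNNReal t) ω)
      = fun ω => ∫ s in (0 : ℝ)..t, M.lam s.toNNReal ω := by
    funext ω
    rw [M.integral_lam_eq ht, intervalIntegral.integral_of_le t.coe_nonneg]
    refine setIntegral_congr_fun measurableSet_Ioc fun u hu => ?_
    simp only [min_eq_left (Real.toNNReal_le_iff_le_coe.2 hu.2)]
  rw [h3] at h2
  exact (StronglyMeasurable.add stronglyMeasurable_const h2).add h1.stronglyMeasurable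

lemma measurable_S {t : ℝ≥0} (ht : t ≤ M.T) : Measurable (M.S t) :=
  (M.stronglyMeasurable_S ht).measurable.mono (M.𝓕.le t) le_rfl

/-- Off `A` the tilted exponent is zero and contributes `Q^min(Aᶜ)`; subtracting this from the total
mass localises the identity to `A`. -/
lemma setLIntegral_exp_increment_Qmin {s t : ℝ≥0} (hst : s ≤ t) (ht : t ≤ M.T) {A : Set Ω}
    (hA : MeasurableSet[M.𝓕 s] A) (θ : EuclideanSpace ℝ (Fin m)) :
    ∫⁻ ω in A, ENNReal.ofReal (Real.exp (inner ℝ θ (M.S t ω - M.S s ω)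
      - (t - s) / 2 * ‖θ‖ ^ 2)) ∂M.Qmin = M.Qmin A := by
  have hA' : MeasurableSet A := M.𝓕.le s A hA
  have hmt := M.measurable_S ht
  have hms := M.measurable_S (hst.trans ht)
  have h := M.lintegral_exp_increment_Qmin_aux hst ht hA θ
  have hme : Measurable fun ω => ENNReal.ofReal (Real.exp (A.indicator (fun ω =>
      inner ℝ θ (M.S t ω - M.S s ω) - (t - s) / 2 * ‖θ‖ ^ 2) ω)) := by
    refine (Real.measurable_exp.comp (Measurable.indicator ?_ hA')).ennreal_ofReal
    fun_prop
  have h1 : ∫⁻ ω, ENNReal.ofReal (Real.exp (A.indicator (fun ω =>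
      inner ℝ θ (M.S t ω - M.S s ω) - (t - s) / 2 * ‖θ‖ ^ 2) ω)) ∂M.Qmin = 1 := by
    rw [Qmin_eq, lintegral_withDensity_eq_lintegral_mul₀ M.aemeasurable_minDensity
      hme.aemeasurable]
    exact h
  rw [← lintegral_add_compl _ hA', setLIntegral_congr_fun hA' (g := fun ω => ENNReal.ofReal
      (Real.exp (inner ℝ θ (M.S t ω - M.S s ω) - (t - s) / 2 * ‖θ‖ ^ 2)))
      (fun ω hω => by simp only [Set.indicator_of_mem hω]),
    setLIntegral_congr_fun hA'.compl (g := fun _ => 1) (fun ω hω => by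
      simp only [Set.indicator_of_notMem hω, Real.exp_zero, ENNReal.ofReal_one]),
    setLIntegral_one] at h1
  have h2 := measure_add_measure_compl (μ := M.Qmin) hA'
  rw [measure_univ, ← h1] at h2
  exact ((ENNReal.add_left_inj (measure_ne_top _ _)).1 h2).symm

lemma setLIntegral_exp_mul_Qmin {s t : ℝ≥0} (hst : s ≤ t) (ht : t ≤ M.T) {A : Set Ω}
    (hA : MeasurableSet[M.𝓕 s] A) (θ : EuclideanSpace ℝ (Fin m)) (r : ℝ) :
    ∫⁻ ω in A, ENNReal.ofReal (Real.exp (r * inner ℝ θ (M.S t ω - M.S s ω))) ∂M.Qmin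
      = ENNReal.ofReal (Real.exp ((t - s) / 2 * ‖θ‖ ^ 2 * r ^ 2)) * M.Qmin A := by
  rw [← M.setLIntegral_exp_increment_Qmin hst ht hA (r • θ),
    ← lintegral_const_mul' _ _ ENNReal.ofReal_ne_top]
  refine lintegral_congr fun ω => ?_
  rw [← ENNReal.ofReal_mul (Real.exp_nonneg _), ← Real.exp_add, real_inner_smul_left, norm_smul,
    mul_pow, Real.norm_eq_abs, sq_abs]
  congr 2
  ring

lemma integrable_exp_mul_Qmin {s t : ℝ≥0} (hst : s ≤ t) (ht : t ≤ M.T) {A : Set Ω}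
    (hA : MeasurableSet[M.𝓕 s] A) (θ : EuclideanSpace ℝ (Fin m)) (r : ℝ) :
    Integrable (fun ω => Real.exp (r * inner ℝ θ (M.S t ω - M.S s ω))) (M.Qmin.restrict A) := by
  have hmt := M.measurable_S ht
  have hms := M.measurable_S (hst.trans ht)
  refine ⟨by fun_prop, ?_⟩
  rw [hasFiniteIntegral_iff_ofReal (ae_of_all _ fun _ => Real.exp_nonneg _),
    M.setLIntegral_exp_mul_Qmin hst ht hA]
  exact ENNReal.mul_lt_top ENNReal.ofReal_lt_top (measure_lt_top _ _)

lemma mgf_increment_Qmin {s t : ℝ≥0} (hst : s ≤ t) (ht : t ≤ M.T) {A : Set Ω}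
    (hA : MeasurableSet[M.𝓕 s] A) (θ : EuclideanSpace ℝ (Fin m)) :
    mgf (fun ω => inner ℝ θ (M.S t ω - M.S s ω)) (M.Qmin.restrict A)
      = fun r => Real.exp ((t - s) / 2 * ‖θ‖ ^ 2 * r ^ 2) * M.Qmin.real A := by
  funext r
  have hi := M.integrable_exp_mul_Qmin hst ht hA θ r
  rw [mgf, integral_eq_lintegral_of_nonneg_ae (ae_of_all _ fun _ => Real.exp_nonneg _) hi.1,
    M.setLIntegral_exp_mul_Qmin hst ht hA, ENNReal.toReal_mul,
    ENNReal.toReal_ofReal (Real.exp_nonneg _), measureReal_def]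

lemma zero_mem_interior_integrableExpSet {s t : ℝ≥0} (hst : s ≤ t) (ht : t ≤ M.T) {A : Set Ω}
    (hA : MeasurableSet[M.𝓕 s] A) (θ : EuclideanSpace ℝ (Fin m)) :
    (0 : ℝ) ∈ interior (integrableExpSet (fun ω => inner ℝ θ (M.S t ω - M.S s ω))
      (M.Qmin.restrict A)) := by
  have : integrableExpSet (fun ω => (inner ℝ θ (M.S t ω - M.S s ω) : ℝ)) (M.Qmin.restrict A)
      = Set.univ := Set.eq_univ_of_forall fun r => M.integrable_exp_mul_Qmin hst ht hA θ r
  rw [this, interior_univ]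
  exact Set.mem_univ _

/-- The mean is the derivative at zero of the moment generating function, which is a constant times
the exponential of a multiple of `r ^ 2`. -/
lemma integral_inner_increment_Qmin {s t : ℝ≥0} (hst : s ≤ t) (ht : t ≤ M.T) {A : Set Ω}
    (hA : MeasurableSet[M.𝓕 s] A) (θ : EuclideanSpace ℝ (Fin m)) :
    ∫ ω in A, inner ℝ θ (M.S t ω - M.S s ω) ∂M.Qmin = 0 := by
  rw [← deriv_mgf_zero (M.zero_mem_interior_integrableExpSet hst ht hA θ),
    M.mgf_increment_Qmin hst ht hA]
  have h : HasDerivAt (fun r : ℝ => Real.exp (((t : ℝ) - s) / 2 * ‖θ‖ ^ 2 * r ^ 2)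
      * M.Qmin.real A) _ 0 :=
    ((((hasDerivAt_id (0 : ℝ)).pow 2).const_mul (((t : ℝ) - s) / 2 * ‖θ‖ ^ 2)).exp).mul_const _
  have h2 := h.deriv
  simp only [id] at h2
  rw [h2]
  simp

lemma integrable_increment_Qmin {s t : ℝ≥0} (hst : s ≤ t) (ht : t ≤ M.T) :
    Integrable (fun ω => M.S t ω - M.S s ω) M.Qmin := by
  have hθ : ∀ θ : EuclideanSpace ℝ (Fin m),
      Integrable (fun ω => (inner ℝ θ (M.S t ω - M.S s ω) : ℝ)) M.Qmin := by
    intro θ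
    have := integrable_of_mem_interior_integrableExpSet (M.zero_mem_interior_integrableExpSet hst ht
      (A := Set.univ) (@MeasurableSet.univ _ (M.𝓕 s)) θ)
    rwa [Measure.restrict_univ] at this
  have h1 : (fun ω => M.S t ω - M.S s ω) = fun ω => ∑ i,
      (inner ℝ (EuclideanSpace.basisFun (Fin m) ℝ i) (M.S t ω - M.S s ω) : ℝ) •
        EuclideanSpace.basisFun (Fin m) ℝ i := by
    funext ω
    exact ((EuclideanSpace.basisFun (Fin m) ℝ).sum_repr' _).symm
  rw [h1]
  exact integrable_finsetSum _ fun i _ => (hθ _).smul_const _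

lemma setIntegral_increment_Qmin {s t : ℝ≥0} (hst : s ≤ t) (ht : t ≤ M.T) {A : Set Ω}
    (hA : MeasurableSet[M.𝓕 s] A) : ∫ ω in A, (M.S t ω - M.S s ω) ∂M.Qmin = 0 := by
  refine ext_inner_left ℝ fun θ => ?_
  rw [← integral_inner (M.integrable_increment_Qmin hst ht).restrict,
    M.integral_inner_increment_Qmin hst ht hA, inner_zero_right]

lemma integrable_S_Qmin {t : ℝ≥0} (ht : t ≤ M.T) : Integrable (M.S t) M.Qmin := by
  have h0 : ∀ᵐ ω ∂M.Qmin, M.S 0 ω = M.S0 := by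
    filter_upwards [M.Qmin_absolutelyContinuous.ae_le M.isBrownianMotion.start] with ω hω
    have : M.W 0 ω = 0 := by
      ext i
      simp [W, firstComponents, hω]
    simp [S, this]
  have h1 := (M.integrable_increment_Qmin zero_le ht).add (integrable_const M.S0)
  refine h1.congr ?_
  filter_upwards [h0] with ω hω
  simp [hω]

theorem martingale_S_Qmin : Martingale (fun t => M.S (min t M.T)) M.𝓕 M.Qmin := by
  refine ⟨fun t => (M.stronglyMeasurable_S (min_le_right t M.T)).mono
    (M.𝓕.mono (min_le_left _ _)), fun s t hst => ?_⟩
  have hst' : min s M.T ≤ min t M.T := min_le_min_right _ hst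
  have hs := M.integrable_S_Qmin (min_le_right s M.T)
  have ht := M.integrable_S_Qmin (min_le_right t M.T)
  refine (ae_eq_condExp_of_forall_setIntegral_eq (M.𝓕.le s) ht (fun _ _ _ => hs.integrableOn)
    (fun A hA _ => ?_) ((M.stronglyMeasurable_S (min_le_right s M.T)).mono
      (M.𝓕.mono (min_le_left _ _))).aestronglyMeasurable).symm
  -- After `T` the stopped price is constant, so only `s ≤ T` needs the increment identity.
  rcases le_total s M.T with h | h
  · rw [min_eq_left h] at hst' hs ⊢
    have h0 := M.setIntegral_increment_Qmin hst' (min_le_right _ _) hA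
    rw [integral_sub ht.integrableOn hs.integrableOn, sub_eq_zero] at h0
    exact h0.symm
  · rw [min_eq_right h, min_eq_right (h.trans hst)]

theorem Qmin_mem_martingaleMeasures : M.Qmin ∈ M.martingaleMeasures :=
  ⟨inferInstance, M.Qmin_absolutelyContinuous, M.absolutelyContinuous_Qmin,
    Locally.of_prop M.martingale_S_Qmin⟩

end BrownianMarket

end TsallisPricing

namespace TsallisPricing

/-! ### Generalized conditional expectations -/

section GenCondExp

variable {Ω : Type*} {𝓖 mΩ : MeasurableSpace Ω} {Q : Measure Ω}

lemma genCondExp_congr {f g : Ω → ℝ} (h : f =ᵐ[Q] g) :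
    genCondExp Q 𝓖 f =ᵐ[Q] genCondExp Q 𝓖 g := by
  have h1 : condLExp 𝓖 Q (fun ω => ENNReal.ofReal (f ω))
      =ᵐ[Q] condLExp 𝓖 Q (fun ω => ENNReal.ofReal (g ω)) := condLExp_congr_ae (by
    filter_upwards [h] with ω hω
    rw [hω])
  have h2 : condLExp 𝓖 Q (fun ω => ENNReal.ofReal (-f ω))
      =ᵐ[Q] condLExp 𝓖 Q (fun ω => ENNReal.ofReal (-g ω)) := condLExp_congr_ae (by
    filter_upwards [h] with ω hω
    rw [hω])
  filter_upwards [h1, h2] with ω e1 e2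
  rw [genCondExp, genCondExp, e1, e2]

lemma genCondExp_eq_condExp {f : Ω → ℝ} (hf : Integrable f Q) :
    genCondExp Q 𝓖 f =ᵐ[Q] fun ω => ((Q[f | 𝓖] ω : ℝ) : EReal) := by
  have hp : Integrable (fun ω => max (f ω) 0) Q := hf.pos_part
  have hn : Integrable (fun ω => max (-f ω) 0) Q := hf.neg_part
  have hp0 : 0 ≤ᵐ[Q] fun ω => max (f ω) 0 := ae_of_all _ fun ω => le_max_right _ _
  have hn0 : 0 ≤ᵐ[Q] fun ω => max (-f ω) 0 := ae_of_all _ fun ω => le_max_right _ _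
  have h1 := condLExp_ofReal 𝓖 hp hp0
  have h2 := condLExp_ofReal 𝓖 hn hn0
  have h3 : Q[f | 𝓖] =ᵐ[Q] Q[fun ω => max (f ω) 0 | 𝓖] - Q[fun ω => max (-f ω) 0 | 𝓖] := by
    refine Filter.EventuallyEq.trans (condExp_congr_ae (ae_of_all _ fun ω => ?_))
      (condExp_sub hp hn 𝓖)
    simp only [Pi.sub_apply]
    rcases le_total 0 (f ω) with h | h
    · rw [max_eq_left h, max_eq_right (neg_nonpos.2 h), sub_zero]
    · rw [max_eq_right h, max_eq_left (neg_nonneg.2 h), zero_sub, neg_neg]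
  have e : ∀ r : ℝ, ENNReal.ofReal (max r 0) = ENNReal.ofReal r := fun r => by
    rw [ENNReal.ofReal_max, ENNReal.ofReal_zero, max_eq_left zero_le]
  simp_rw [e] at h1 h2
  filter_upwards [h1, h2, h3, condExp_nonneg hp0 (m := 𝓖), condExp_nonneg hn0 (m := 𝓖)]
    with ω e1 e2 e3 e4 e5
  rw [genCondExp, e1, e2, e3, Pi.sub_apply, EReal.coe_sub, EReal.coe_ennreal_ofReal,
    EReal.coe_ennreal_ofReal, max_eq_left (show (0 : ℝ) ≤ _ from e4),
    max_eq_left (show (0 : ℝ) ≤ _ from e5)]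

variable [IsProbabilityMeasure Q]

/-- The hypothesis is rewritten without subtraction as `x + f⁻ ≤ f⁺ + 1`, and the two conditional
means equal to one cancel. As also `f⁻ ≤ 1`, the negative part has finite conditional expectation
and `∞ - ∞` cannot occur; `f` need not be integrable. -/
lemma genCondExp_nonneg_of_sub_one_le (h𝓖 : 𝓖 ≤ mΩ) {f x : Ω → ℝ} (hx : Measurable[mΩ] x)
    (hx0 : ∀ᵐ ω ∂Q, 0 ≤ x ω) (hfx : ∀ᵐ ω ∂Q, x ω - 1 ≤ f ω)
    (hx1 : condLExp 𝓖 Q (fun ω => ENNReal.ofReal (x ω)) =ᵐ[Q] fun _ => 1) :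
    ∀ᵐ ω ∂Q, 0 ≤ genCondExp Q 𝓖 f ω := by
  have h1 := condLExp_mono (mΩ := 𝓖) (P := Q)
    (X := (fun ω => ENNReal.ofReal (x ω)) + fun ω => ENNReal.ofReal (-f ω))
    (Y := (fun ω => ENNReal.ofReal (f ω)) + fun _ => 1) (by
      filter_upwards [hx0, hfx] with ω h0 h1
      simp only [Pi.add_apply]
      rw [← ENNReal.ofReal_one]
      rcases le_total 0 (f ω) with h | h
      · rw [ENNReal.ofReal_of_nonpos (neg_nonpos.2 h), add_zero, ← ENNReal.ofReal_add h zero_le_one]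
        exact ENNReal.ofReal_le_ofReal (by linarith)
      · rw [ENNReal.ofReal_of_nonpos h, zero_add, ← ENNReal.ofReal_add h0 (neg_nonneg.2 h)]
        exact ENNReal.ofReal_le_ofReal (by linarith))
  have h2 := condLExp_add_left (mΩ := 𝓖) (P := Q) (X := fun ω => ENNReal.ofReal (x ω))
    (fun ω => ENNReal.ofReal (-f ω)) hx.ennreal_ofReal.aemeasurable
  have h3 := condLExp_add_right (mΩ := 𝓖) (P := Q) (fun ω => ENNReal.ofReal (f ω))
    (Y := fun _ => 1) aemeasurable_const
  have h4 := condLExp_mono (mΩ := 𝓖) (P := Q) (X := fun ω => ENNReal.ofReal (-f ω))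
    (Y := fun _ => 1) (by
      filter_upwards [hx0, hfx] with ω h0 h1
      rw [← ENNReal.ofReal_one]
      exact ENNReal.ofReal_le_ofReal (by linarith))
  rw [condLExp_const h𝓖] at h3 h4
  filter_upwards [h1, h2, h3, h4, hx1] with ω e1 e2 e3 e4 e5
  rw [e2, e3, Pi.add_apply, Pi.add_apply, e5, add_comm,
    ENNReal.add_le_add_iff_right ENNReal.one_ne_top] at e1
  have hfin : condLExp 𝓖 Q (fun ω => ENNReal.ofReal (-f ω)) ω ≠ ∞ :=
    ne_top_of_le_ne_top ENNReal.one_ne_top e4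
  rw [genCondExp, EReal.sub_nonneg (Or.inr (by simpa using hfin)) (by simp)]
  exact_mod_cast e1

end GenCondExp

/-! ### Convexity of the Tsallis entropy -/

/-- For `x > 0` the right side is `(x - x ^ q) / (1 - q)`. Bernoulli compares `x ^ q` with its
tangent at `1`; the inequality reverses when `q` crosses `1`, together with the sign of `1 - q`. -/
lemma sub_one_le_rpow_mul_lnq {q x : ℝ} (hq : 0 < q) (hq1 : q ≠ 1) (hx : 0 ≤ x) :
    x - 1 ≤ x ^ q * lnq q x := by
  rcases hx.eq_or_lt with rfl | hx
  · rw [Real.zero_rpow hq.ne', zero_mul]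
    norm_num
  have h1 : x ^ q * lnq q x = (x - x ^ q) / (1 - q) := by
    rw [lnq, mul_div_assoc', mul_sub, ← Real.rpow_add hx, mul_one]
    norm_num
  rw [h1]
  rcases lt_or_gt_of_ne hq1 with h | h
  · have h2 := rpow_one_add_le_one_add_mul_self (s := x - 1) (by linarith) hq.le h.le
    rw [add_sub_cancel] at h2
    rw [le_div_iff₀ (by linarith)]
    nlinarith
  · have h2 := one_add_mul_self_le_rpow_one_add (s := x - 1) (by linarith) h.le
    rw [add_sub_cancel] at h2
    rw [le_div_iff_of_neg (by linarith)]
    nlinarith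

lemma lnq_one (q : ℝ) : lnq q 1 = 0 := by
  simp [lnq]

namespace BrownianMarket

variable {Ω : Type*} [mΩ : MeasurableSpace Ω] {m n : ℕ} (M : BrownianMarket Ω m n)

/-! ### Density ratios -/

section Density

variable {Q ν : Measure Ω}

lemma measurable_density (t : ℝ≥0) : Measurable (M.density Q ν t) :=
  stronglyMeasurable_condExp.measurable.mono (M.𝓕.le t) le_rfl

lemma density_nonneg (t : ℝ≥0) : ∀ᵐ ω ∂ν, 0 ≤ M.density Q ν t ω :=
  condExp_nonneg (ae_of_all _ fun _ => ENNReal.toReal_nonneg)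

variable [IsProbabilityMeasure Q] [IsProbabilityMeasure ν]

/-- The set where the density is nonpositive belongs to `𝓕 t`, so the derivative `dQ/dν` integrates
to zero there. That derivative is strictly positive, so the set is null. -/
lemma density_pos (hQν : Q ≪ ν) (hνQ : ν ≪ Q) (t : ℝ≥0) : ∀ᵐ ω ∂ν, 0 < M.density Q ν t ω := by
  have hd : Integrable (fun ω => (Q.rnDeriv ν ω).toReal) ν := Measure.integrable_toReal_rnDeriv
  have hpos : ∀ᵐ ω ∂ν, 0 < (Q.rnDeriv ν ω).toReal := by
    filter_upwards [hνQ.ae_le (Measure.rnDeriv_pos hQν), Q.rnDeriv_lt_top ν] with ω h1 h2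
      using ENNReal.toReal_pos h1.ne' h2.ne
  have hA : MeasurableSet[M.𝓕 t] {ω | M.density Q ν t ω ≤ 0} :=
    measurableSet_le stronglyMeasurable_condExp.measurable measurable_const
  have hA' := M.𝓕.le t _ hA
  have h1 : ∫ ω in {ω | M.density Q ν t ω ≤ 0}, M.density Q ν t ω ∂ν
      = ∫ ω in {ω | M.density Q ν t ω ≤ 0}, (Q.rnDeriv ν ω).toReal ∂ν :=
    setIntegral_condExp (M.𝓕.le t) hd hA
  have h2 : ∫ ω in {ω | M.density Q ν t ω ≤ 0}, M.density Q ν t ω ∂ν ≤ 0 :=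
    setIntegral_nonpos hA' fun ω hω => hω
  have h3 : ∫ ω in {ω | M.density Q ν t ω ≤ 0}, (Q.rnDeriv ν ω).toReal ∂ν = 0 :=
    le_antisymm (h1 ▸ h2) (integral_nonneg fun _ => ENNReal.toReal_nonneg)
  rw [setIntegral_eq_zero_iff_of_nonneg_ae (ae_of_all _ fun _ => ENNReal.toReal_nonneg)
    hd.integrableOn] at h3
  have h4 := (ae_restrict_iff' hA').1 h3
  filter_upwards [h4, hpos] with ω e1 e2
  by_contra hcon
  exact e2.ne' (e1 (not_lt.1 hcon))

/-- The measures with densities `D_T` and `D_t` agree on `𝓕 t`. Comparing their traces there covers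
all nonnegative `g`, integrable or not. -/
lemma lintegral_mul_density {t : ℝ≥0} (ht : t ≤ M.T) {g : Ω → ℝ≥0∞} (hg : Measurable[M.𝓕 t] g) :
    ∫⁻ ω, ENNReal.ofReal (M.density Q ν M.T ω) * g ω ∂ν
      = ∫⁻ ω, ENNReal.ofReal (M.density Q ν t ω) * g ω ∂ν := by
  have hd : Integrable (fun ω => (Q.rnDeriv ν ω).toReal) ν := Measure.integrable_toReal_rnDeriv
  have hg' : Measurable g := hg.mono (M.𝓕.le t) le_rfl
  have hset : ∀ s ≤ M.T, t ≤ s → ∀ A, MeasurableSet[M.𝓕 t] A →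
      ∫⁻ ω in A, ENNReal.ofReal (M.density Q ν s ω) ∂ν
        = ENNReal.ofReal (∫ ω in A, (Q.rnDeriv ν ω).toReal ∂ν) := by
    intro s _ hts A hA
    rw [← setIntegral_condExp (M.𝓕.le s) hd (M.𝓕.mono hts _ hA),
      ofReal_integral_eq_lintegral_ofReal integrable_condExp.integrableOn
        (ae_restrict_of_ae (M.density_nonneg s))]
    rfl
  have htrim : (ν.withDensity fun ω => ENNReal.ofReal (M.density Q ν M.T ω)).trim (M.𝓕.le t)
      = (ν.withDensity fun ω => ENNReal.ofReal (M.density Q ν t ω)).trim (M.𝓕.le t) := by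
    refine @Measure.ext _ (M.𝓕 t) _ _ fun A hA => ?_
    rw [trim_measurableSet_eq _ hA, trim_measurableSet_eq _ hA,
      withDensity_apply _ (M.𝓕.le t _ hA), withDensity_apply _ (M.𝓕.le t _ hA),
      hset _ le_rfl ht A hA, hset _ ht le_rfl A hA]
  have h1 := lintegral_withDensity_eq_lintegral_mul ν
    (M.measurable_density (Q := Q) (ν := ν) M.T).ennreal_ofReal hg'
  have h2 := lintegral_withDensity_eq_lintegral_mul ν
    (M.measurable_density (Q := Q) (ν := ν) t).ennreal_ofReal hg'
  rw [← lintegral_trim (M.𝓕.le t) hg] at h1 h2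
  rw [htrim] at h1
  exact h1.symm.trans h2

lemma condLExp_densityRatio (hQν : Q ≪ ν) (hνQ : ν ≪ Q) {t : ℝ≥0} (ht : t ≤ M.T) :
    condLExp (M.𝓕 t) ν (fun ω => ENNReal.ofReal (M.densityRatio Q ν t M.T ω)) =ᵐ[ν] fun _ => 1 := by
  refine (ae_eq_condLExp (M.𝓕.le t) ν _ measurable_const fun A hA => ?_).symm
  have hA' := M.𝓕.le t A hA
  have hDt : Measurable[M.𝓕 t] (fun ω => (ENNReal.ofReal (M.density Q ν t ω))⁻¹) :=
    (stronglyMeasurable_condExp.measurable.ennreal_ofReal).inv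
  have hpos := M.density_pos hQν hνQ t
  -- The test function is `1_A / D_t`: against `D_T` it gives the ratio on `A`, against `D_t` the
  -- indicator of `A`.
  have h := M.lintegral_mul_density (Q := Q) (ν := ν) ht (Measurable.indicator hDt hA)
  rw [← lintegral_indicator hA', ← lintegral_indicator hA']
  refine Eq.trans (lintegral_congr_ae ?_) (h.symm.trans (lintegral_congr_ae ?_))
  · filter_upwards [hpos] with ω hω
    by_cases hωA : ω ∈ A
    · rw [Set.indicator_of_mem hωA, Set.indicator_of_mem hωA,
        ENNReal.mul_inv_cancel (ENNReal.ofReal_pos.2 hω).ne' ENNReal.ofReal_ne_top]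
    · rw [Set.indicator_of_notMem hωA, Set.indicator_of_notMem hωA, mul_zero]
  · filter_upwards [hpos] with ω hω
    by_cases hωA : ω ∈ A
    · rw [Set.indicator_of_mem hωA, Set.indicator_of_mem hωA, densityRatio,
        ENNReal.ofReal_div_of_pos hω, ENNReal.div_eq_inv_mul, mul_comm]
    · rw [Set.indicator_of_notMem hωA, Set.indicator_of_notMem hωA, mul_zero]

/-- The pointwise tangent bound plays the part of conditional Jensen, so finite entropy is not
needed. -/
lemma condEntropy_nonneg {q : ℝ} (hq : 0 < q) (hq1 : q ≠ 1) (hQν : Q ≪ ν) (hνQ : ν ≪ Q)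
    {t : ℝ≥0} (ht : t ≤ M.T) : ∀ᵐ ω ∂ν, 0 ≤ M.condEntropy q t Q ν ω := by
  have hx0 : ∀ᵐ ω ∂ν, 0 ≤ M.densityRatio Q ν t M.T ω := by
    filter_upwards [M.density_nonneg (Q := Q) (ν := ν) t, M.density_nonneg (Q := Q) (ν := ν) M.T]
      with ω h1 h2 using div_nonneg h2 h1
  refine genCondExp_nonneg_of_sub_one_le (M.𝓕.le t)
    ((M.measurable_density M.T).div (M.measurable_density t)) hx0 ?_
    (M.condLExp_densityRatio hQν hνQ ht)
  filter_upwards [hx0] with ω hω using sub_one_le_rpow_mul_lnq hq hq1 hω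

lemma density_self (t : ℝ≥0) : ∀ᵐ ω ∂ν, M.density ν ν t ω = 1 := by
  have h1 : (fun ω => (ν.rnDeriv ν ω).toReal) =ᵐ[ν] fun _ => (1 : ℝ) := by
    filter_upwards [Measure.rnDeriv_self ν] with ω hω
    rw [hω, ENNReal.toReal_one]
  have h2 := condExp_congr_ae (m := M.𝓕 t) h1
  rw [condExp_const (M.𝓕.le t)] at h2
  exact h2

lemma densityRatio_self (s t : ℝ≥0) : ∀ᵐ ω ∂ν, M.densityRatio ν ν s t ω = 1 := by
  filter_upwards [M.density_self (ν := ν) s, M.density_self (ν := ν) t] with ω h1 h2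
  rw [densityRatio, h1, h2, div_one]

lemma condEntropy_self (q : ℝ) (t : ℝ≥0) : ∀ᵐ ω ∂ν, M.condEntropy q t ν ν ω = 0 := by
  have h1 : (fun ω => M.densityRatio ν ν t M.T ω ^ q * lnq q (M.densityRatio ν ν t M.T ω))
      =ᵐ[ν] fun _ => 0 := by
    filter_upwards [M.densityRatio_self (ν := ν) t M.T] with ω hω
    rw [hω, lnq_one, mul_zero]
  have h2 := genCondExp_eq_condExp (Q := ν) (𝓖 := M.𝓕 t) (integrable_zero Ω ℝ ν)
  filter_upwards [genCondExp_congr (𝓖 := M.𝓕 t) h1, h2] with ω e1 e2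
  have e3 : genCondExp ν (M.𝓕 t) (fun _ => 0) ω = 0 := by
    refine e2.trans ?_
    rw [condExp_zero]
    rfl
  exact e1.trans e3

end Density

lemma Qmin_mem_finiteEntropyMeasures (q : ℝ) : M.Qmin ∈ M.finiteEntropyMeasures q := by
  refine ⟨M.Qmin_mem_martingaleMeasures, ?_⟩
  have h1 : (fun ω => M.density M.Qmin M.Qmin M.T ω ^ q * lnq q (M.density M.Qmin M.Qmin M.T ω))
      =ᵐ[M.Qmin] fun _ => 0 := by
    filter_upwards [M.density_self (ν := M.Qmin) M.T] with ω hω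
    rw [hω, lnq_one, mul_zero]
  rw [entropy, if_pos ⟨Measure.AbsolutelyContinuous.rfl,
    (integrable_zero Ω ℝ M.Qmin).congr h1.symm⟩]
  exact EReal.coe_lt_top _

/-! ### Bounded claims -/

/-- Raising `expq` to the power `1 - q` gives back an affine function of `ξ`. It is nonnegative by
the domain condition and bounded above by a power of `m₂` if `q < 1`, of `m₁` if `q > 1`; the
maximum covers both cases. -/
lemma exists_abs_le_of_mem_boundedClaims {q γ : ℝ} (hq1 : q ≠ 1) (hγ : 0 < γ) {ξ : Ω → ℝ}
    (hξ : ξ ∈ M.boundedClaims q γ) : ∃ K : ℝ, ∀ᵐ ω ∂M.P, |ξ ω| ≤ K := by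
  obtain ⟨⟨-, hdom, -, -⟩, m₁, m₂, hm₁, hbd⟩ := hξ
  have hq : 1 - q ≠ 0 := sub_ne_zero.2 hq1.symm
  refine ⟨(1 + max (m₁ ^ (1 - q)) (m₂ ^ (1 - q))) / (|1 - q| * γ), ?_⟩
  filter_upwards [hdom, hbd] with ω hω ⟨h1, h2⟩
  have hb : 0 ≤ 1 + (1 - q) * (-γ * ξ ω) := by
    rcases hω with ⟨h, h'⟩ | ⟨h, h'⟩
    · have h0 : 0 < 1 - q := sub_pos.2 h
      have := mul_le_mul_of_nonneg_left h' h0.le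
      rw [mul_neg, mul_one_div_cancel hq] at this
      linarith
    · have h0 : 1 - q < 0 := sub_neg.2 h
      have := mul_lt_mul_of_neg_left h' h0
      rw [mul_neg, mul_one_div_cancel hq] at this
      linarith
  have hpow : expq q (-γ * ξ ω) ^ (1 - q) = 1 + (1 - q) * (-γ * ξ ω) := by
    rw [expq, ← Real.rpow_mul hb, one_div_mul_cancel hq, Real.rpow_one]
  have hy : 0 < expq q (-γ * ξ ω) := hm₁.trans_le h1
  have hle : expq q (-γ * ξ ω) ^ (1 - q) ≤ max (m₁ ^ (1 - q)) (m₂ ^ (1 - q)) := by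
    rcases le_total 0 (1 - q) with h | h
    · exact (Real.rpow_le_rpow hy.le h2 h).trans (le_max_right _ _)
    · exact (Real.rpow_le_rpow_of_nonpos hm₁ h1 h).trans (le_max_left _ _)
  rw [hpow] at hle
  rw [le_div_iff₀ (by positivity)]
  have e : |ξ ω| * (|1 - q| * γ) = |(1 - q) * (-γ * ξ ω)| := by
    rw [abs_mul, abs_mul, abs_neg, abs_of_pos hγ]
    ring
  rw [e, abs_le]
  constructor <;> linarith

lemma integrable_Qmin_of_mem_boundedClaims {q γ : ℝ} (hq1 : q ≠ 1) (hγ : 0 < γ) {ξ : Ω → ℝ}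
    (hξ : ξ ∈ M.boundedClaims q γ) : Integrable ξ M.Qmin := by
  obtain ⟨K, hK⟩ := M.exists_abs_le_of_mem_boundedClaims hq1 hγ hξ
  have hm : Measurable ξ := hξ.1.1.mono (M.𝓕.le _) le_rfl
  exact Integrable.of_bound hm.aestronglyMeasurable K (M.Qmin_absolutelyContinuous.ae_le hK)

lemma distortedExp_Qmin (q : ℝ) (t : ℝ≥0) {ξ : Ω → ℝ} (hξ : Integrable ξ M.Qmin) :
    ∀ᵐ ω ∂M.Qmin, M.distortedExp q t ξ M.Qmin ω = ((M.Qmin[ξ | M.𝓕 t] ω : ℝ) : EReal) := by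
  have h1 : (fun ω => M.densityRatio M.Qmin M.Qmin t M.T ω ^ q * ξ ω) =ᵐ[M.Qmin] ξ := by
    filter_upwards [M.densityRatio_self (ν := M.Qmin) t M.T] with ω hω
    rw [hω, Real.one_rpow, one_mul]
  exact (genCondExp_congr h1).trans (genCondExp_eq_condExp hξ)

end BrownianMarket

end TsallisPricing

end

/-! ### The two bounds on the price -/

theorem corollary5p1 {Ω : Type*} [MeasurableSpace Ω] {m n : ℕ}
    (M : TsallisPricing.BrownianMarket Ω m n) (q γ : ℝ) (hq : 0 < q) (hq1 : q ≠ 1) (hγ : 0 < γ)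
    (t : ℝ≥0) (ht : t ≤ M.T) (ξ : Ω → ℝ) (hξ : ξ ∈ M.boundedClaims q γ) :
    ∀ᵐ ω ∂M.P, M.worstDistortedExp q t ξ ω ≤ M.price q γ t ξ ω ∧
      M.price q γ t ξ ω ≤ ((M.Qmin[ξ | M.𝓕 t] ω : ℝ) : EReal) := by
  have hworst := TsallisPricing.isEssInf_essInfFamily M.P
    fun (Q : M.finiteEntropyMeasures q) ω => M.distortedExp q t ξ Q ω
  have hprice := TsallisPricing.isEssInf_essInfFamily M.P fun (Q : M.finiteEntropyMeasures q) ω =>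
    M.distortedExp q t ξ Q ω + ((1 / γ : ℝ) : EReal) * M.condEntropy q t Q M.Qmin ω
  have hlow : ∀ᵐ ω ∂M.P, M.worstDistortedExp q t ξ ω ≤ M.price q γ t ξ ω := by
    refine hprice.greatest _ hworst.measurable fun Q => ?_
    obtain ⟨⟨hQ, hQP, hPQ, -⟩, -⟩ := Q.2
    -- Nonnegativity holds almost surely under `Q^min`; equivalence of the measures transfers it to
    -- `P`, where the essential infima are taken.
    have hent := M.absolutelyContinuous_Qmin.ae_le (M.condEntropy_nonneg hq hq1
      (hQP.trans M.absolutelyContinuous_Qmin) (M.Qmin_absolutelyContinuous.trans hPQ) ht)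
    filter_upwards [hworst.le Q, hent] with ω h1 h2
    have hγ' : (0 : EReal) ≤ ((1 / γ : ℝ) : EReal) := by
      exact_mod_cast (one_div_pos.2 hγ).le
    exact h1.trans (le_add_of_nonneg_right (mul_nonneg hγ' h2))
  -- The upper bound needs a single competitor, `Q^min` itself.
  have hup := hprice.le ⟨M.Qmin, M.Qmin_mem_finiteEntropyMeasures q⟩
  have hself := M.absolutelyContinuous_Qmin.ae_le (M.condEntropy_self (ν := M.Qmin) q t)
  have hdist := M.absolutelyContinuous_Qmin.ae_le (M.distortedExp_Qmin q t
    (M.integrable_Qmin_of_mem_boundedClaims hq1 hγ hξ))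
  filter_upwards [hlow, hup, hself, hdist] with ω h1 h2 h3 h4
  refine ⟨h1, ?_⟩
  simp only [h3, h4, mul_zero, add_zero] at h2
  exact h2
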